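/- For $\beta \ge 0$ and $R > 1$ let $X_\beta = (R^{\beta}\mathbb{Z} \times R^{2\beta}\mathbb{Z}) \cap [-R,R]^2 \subset \mathbb{R}^2$. For a compact smooth curve $\Gamma \subset \mathbb{R}^2$ with arc-length measure $\mathrm{d}s$ and $f \in L^2(\mathrm{d}s)$, let $E_\Gamma f(x) = \int_\Gamma f(\xi) e^{2\pi i x\cdot\xi}\,\mathrm{d}s(\xi)$, $x \in \mathbb{R}^2$, be the Fourier extension of $f$, and let $\|E_\Gamma\|_{L^2(\mathrm{d}s)\to l^2(X_\beta)}$ be the norm of $f \mapsto E_\Gamma f|_{X_\beta}$ as an operator from $L^2(\mathrm{d}s)$ to $l^2(X_\beta)$. (i) Let $S^1$ be the unit circle. For every $\varepsilon > 0$ there is a constant $C_\varepsilon > 0$, depending only on $\varepsilon$, such that for all $0 \le \beta \le \frac{1}{28}$ and all $R > 1$, $$\|E_{S^1}\|_{L^2(\mathrm{d}s)\to l^2(X_\beta)} \le C_\varepsilon R^{\frac12 - \frac32\beta + \varepsilon};$$ equivalently, $\|E_{S^1} f\|_{l^2(X_\beta)} \le C_\varepsilon R^{\frac12-\frac32\beta+\varepsilon}\|f\|_{L^2(\mathrm{d}s)}$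 for all $f \in L^2(\mathrm{d}s)$. (ii) By contrast, let $P^1 = \{(t,t^2) : |t| \le 1\}$ be the truncated unit parabola. There is an absolute constant $c > 0$ such that for all $0 \le \beta \le \frac12$ and all $R > 1$, $$\|E_{P^1}\|_{L^2(\mathrm{d}s)\to l^2(X_\beta)} \ge c\, R^{\frac12-\beta}.$$ -/

import Mathlib

open MeasureTheory

noncomputable section

/-- The Euclidean plane. -/
abbrev Plane : Type := EuclideanSpace ℝ (Fin 2)

/-- The arc-length measure `ds` carried by the curve `γ : [a, b] → ℝ²` (for `γ` of class `C¹` and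
injective up to the endpoints): `∫ f ds = ∫_a^b f (γ t) |γ' t| dt`. -/
def arcLength (γ : ℝ → Plane) (a b : ℝ) : Measure Plane :=
  ((volume.restrict (Set.Icc a b)).withDensity (fun t => ‖deriv γ t‖ₑ)).map γ

/-- The arc-length measure of the unit circle `S¹`. -/
def circleMeasure : Measure Plane :=
  arcLength (fun t => !₂[Real.cos t, Real.sin t]) 0 (2 * Real.pi)

/-- The arc-length measure of the truncated unit parabola `P¹ = {(t, t²) : |t| ≤ 1}`. -/
def parabolaMeasure : Measure Plane :=
  arcLength (fun t => !₂[t, t ^ 2]) (-1) 1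

/-- The Fourier extension `E f (x) = ∫ f(ξ) e^{2 π i x · ξ} ds(ξ)`. -/
def fourierExt (s : Measure Plane) (f : Plane → ℂ) (x : Plane) : ℂ :=
  ∫ ξ, f ξ * Complex.exp (2 * Real.pi * Complex.I * (inner ℝ x ξ : ℝ)) ∂s

/-- The `l²(X)` norm of a function, as an extended nonnegative real. -/
def l2Norm (X : Set Plane) (g : Plane → ℂ) : ENNReal :=
  (∑' x : X, ‖g x‖ₑ ^ 2) ^ (1 / 2 : ℝ)

/-- The operator norm `‖E‖_{L²(ds) → l²(X)}`, the supremum of `‖E f‖_{l²(X)}` over the closed unit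
ball of `L²(ds)`. -/
def extOpNorm (s : Measure Plane) (X : Set Plane) : ENNReal :=
  ⨆ (f : Plane → ℂ) (_ : MemLp f 2 s) (_ : eLpNorm f 2 s ≤ 1), l2Norm X (fourierExt s f)

/-- `X_β = (R^β ℤ × R^{2β} ℤ) ∩ [-R, R]²`. -/
def latticeBox (β R : ℝ) : Set Plane :=
  {x | (∃ m₁ m₂ : ℤ, x 0 = m₁ * R ^ β ∧ x 1 = m₂ * R ^ (2 * β)) ∧
    x 0 ∈ Set.Icc (-R) R ∧ x 1 ∈ Set.Icc (-R) R}

end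

/-! Write A = R^β. For the circle, a Gaussian weight on the whole lattice Aℤ × A²ℤ dominates the box
up to the factor e^{2π}. By T T* (`tsum_mul_enorm_integral_sq_le`) the weighted sum of |Ef|² is
bounded by a quadratic form in |f|. Poisson summation turns its kernel into Gaussians of height
R²/A³ and width 1/R at the points of the dual lattice A⁻¹ℤ × A⁻²ℤ. By Schur's test
(`lintegral_schur_le`) it suffices to integrate this kernel in one variable. Each Gaussian has mass
O(1/R) on the circle, and it matters only if its centre ξ - p is close to the circle. So the squared
norm is at most R/A³ times the number of dual lattice points p with |ξ - p| nearly 1.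

That number is O(A^ε) (`exists_card_nearCircle_le`). Such points, rescaled to integer vectors (m,
n), nearly satisfy a quadratic equation whose only unknowns are the two coordinates of ξ. A 3×3
determinant eliminates them and leaves an approximate relation between two integers. Because R ≥
A^28 the error is so small that integrality makes the relations between the determinants exact, with
common coefficients p, q > 0 of size O(A^7) (`exists_relation`). Hence the points lie on one
integral ellipse through the origin, of polynomial size in A, unless they all lie on one line
through the origin. Completing squares gives X² + pqY² = M, which has at most 10 d(M)² solutions
(`card_ellipse_le`), and the divisor bound finishes.

For the parabola the count fails: it passes through the dual lattice points (j/A, j²/A²). At all of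
these every lattice phase is an integer, so the normalised indicator of short caps there makes |Ef|
large on the whole box (`le_extOpNorm_of_resonance`, `half_le_cos_of_mem_capUnion`). -/

/-! ### The divisor bound and integer points on ellipses. -/

/-- The divisor bound: `d(n) ≤ C_ε n^ε`. -/
theorem exists_card_divisors_le_rpow (ε : ℝ) (hε : 0 < ε) :
    ∃ C : ℝ, 1 ≤ C ∧ ∀ n : ℕ, n ≠ 0 → (n.divisors.card : ℝ) ≤ C * (n : ℝ) ^ ε := by
  obtain ⟨P, hP⟩ := exists_nat_ge ((2 : ℝ) ^ (1 / ε))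
  have hl2 : 0 < Real.log 2 := Real.log_pos one_lt_two
  set K : ℝ := 1 + 1 / (ε * Real.log 2) with hK
  have hK1 : 1 ≤ K := by rw [hK]; have : 0 < 1 / (ε * Real.log 2) := by positivity
                         linarith
  refine ⟨K ^ P, one_le_pow₀ hK1, fun n hn => ?_⟩
  -- Primes p ≥ P have p^ε ≥ 2, so a + 1 ≤ 2^a costs nothing. The fewer than P smaller primes cost a
  -- factor K each.
  have key : ∀ p ∈ n.primeFactors, ((n.factorization p + 1 : ℕ) : ℝ) ≤
      (if p < P then K else 1) * ((p : ℝ) ^ (n.factorization p)) ^ ε := by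
    intro p hp
    have hp2 : 2 ≤ p := (Nat.prime_of_mem_primeFactors hp).two_le
    have hp2' : (2 : ℝ) ≤ p := by exact_mod_cast hp2
    have hp0 : (0 : ℝ) < p := by linarith
    generalize n.factorization p = a
    split_ifs with h
    · have h1 : ((p : ℝ) ^ a) ^ ε = Real.exp (a * Real.log p * ε) := by
        rw [Real.rpow_def_of_pos (by positivity), Real.log_pow]
      have h2 : Real.log 2 ≤ Real.log p := Real.log_le_log (by norm_num) hp2'
      have h3 : 1 + a * (ε * Real.log 2) ≤ ((p : ℝ) ^ a) ^ ε := by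
        rw [h1]
        have := Real.add_one_le_exp (a * Real.log p * ε)
        have h4 : a * (ε * Real.log 2) ≤ a * Real.log p * ε := by
          have : (a : ℝ) * ε * Real.log 2 ≤ a * ε * Real.log p := by gcongr
          linarith
        linarith
      calc ((a + 1 : ℕ) : ℝ) ≤ K * (1 + a * (ε * Real.log 2)) := by
            have h5 : K * (1 + a * (ε * Real.log 2)) =
                1 + a + 1 / (ε * Real.log 2) + a * (ε * Real.log 2) := by
              rw [hK]; field_simp; ring
            rw [h5]; push_cast
            have : 0 < 1 / (ε * Real.log 2) := by positivity
            have : 0 ≤ a * (ε * Real.log 2) := by positivity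
            linarith
        _ ≤ _ := by gcongr
    · have h1 : (2 : ℝ) ≤ (p : ℝ) ^ ε := by
        have : (2 : ℝ) ^ (1 / ε) ≤ p := hP.trans (by exact_mod_cast not_lt.mp h)
        calc (2 : ℝ) = ((2 : ℝ) ^ (1 / ε)) ^ ε := by
              rw [← Real.rpow_mul (by norm_num)]; simp [hε.ne']
          _ ≤ _ := by gcongr
      have h2 : ((p : ℝ) ^ a) ^ ε = ((p : ℝ) ^ ε) ^ a := by
        rw [← Real.rpow_natCast, ← Real.rpow_natCast, ← Real.rpow_mul hp0.le,
          ← Real.rpow_mul hp0.le, mul_comm]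
      rw [one_mul, h2]
      calc ((a + 1 : ℕ) : ℝ) ≤ (2 : ℝ) ^ a := by exact_mod_cast Nat.lt_two_pow_self
        _ ≤ _ := by gcongr
  have hprod : (n : ℝ) ^ ε = ∏ p ∈ n.primeFactors, ((p : ℝ) ^ (n.factorization p)) ^ ε := by
    rw [Real.finsetProd_rpow _ _ (fun i _ => by positivity)]
    congr 1
    conv_lhs => rw [← Nat.prod_factorization_pow_eq_self hn]
    rw [Finsupp.prod]; push_cast; rfl
  rw [Nat.card_divisors hn, Nat.cast_prod, hprod]
  refine (Finset.prod_le_prod (fun _ _ => by positivity) key).trans ?_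
  rw [Finset.prod_mul_distrib]
  gcongr
  rw [Finset.prod_ite]
  simp only [Finset.prod_const, one_pow, mul_one]
  apply pow_le_pow_right₀ hK1
  calc _ ≤ (Finset.range P).card := Finset.card_le_card (by intro x; simp)
    _ = P := by simp

/-- Two points of `X² + D Y² = M` with prescribed cross product with a third one and prescribed
sign of the dot product coincide. -/
theorem ellipse_eq_of_cross_eq {D M X Y X' Y' U V : ℤ} (hM : 0 < M)
    (h0 : U ^ 2 + D * V ^ 2 = M)
    (h : X ^ 2 + D * Y ^ 2 = M) (h' : X' ^ 2 + D * Y' ^ 2 = M)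
    (hc : X * V - U * Y = X' * V - U * Y')
    (hs : (0 ≤ X * U + D * Y * V) ↔ (0 ≤ X' * U + D * Y' * V)) : X = X' ∧ Y = Y' := by
  -- Brahmagupta's identity: dot² + D · cross² = M². Cross product and sign thus fix the dot
  -- product, and (dot, cross) determines (X, Y) by a linear system of determinant M up to sign.
  have e1 : (X * U + D * Y * V) ^ 2 = (X' * U + D * Y' * V) ^ 2 := by
    have a1 : (X * U + D * Y * V) ^ 2 = M * M - D * (X * V - U * Y) ^ 2 := by
      rw [← h0]; nth_rewrite 2 [h0]; rw [← h]; ring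
    have a2 : (X' * U + D * Y' * V) ^ 2 = M * M - D * (X' * V - U * Y') ^ 2 := by
      rw [← h0]; nth_rewrite 2 [h0]; rw [← h']; ring
    rw [a1, a2, hc]
  have e2 : X * U + D * Y * V = X' * U + D * Y' * V := by
    rcases sq_eq_sq_iff_eq_or_eq_neg.mp e1 with h1 | h1
    · exact h1
    · by_cases h2 : 0 ≤ X * U + D * Y * V
      · have := hs.mp h2; linarith
      · have := mt hs.mpr h2; linarith
  constructor
  · have : M * X = M * X' := by
      rw [← h0]; linear_combination U * e2 + D * V * hc
    exact mul_left_cancel₀ hM.ne' this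
  · have : M * Y = M * Y' := by
      rw [← h0]; linear_combination V * e2 - U * hc
    exact mul_left_cancel₀ hM.ne' this

theorem dvd_of_div_gcd {a b M : ℤ} (hM : 0 < M) (h : M ∣ a * b) :
    M / (Int.gcd a M : ℤ) ∣ b := by
  have hg : 0 < Int.gcd a M := Int.gcd_pos_of_ne_zero_right _ hM.ne'
  have hc : IsCoprime (M / (Int.gcd a M : ℤ)) (a / (Int.gcd a M : ℤ)) := by
    rw [Int.isCoprime_iff_gcd_eq_one, Int.gcd_comm]
    exact Int.gcd_ediv_gcd_ediv_gcd hg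
  apply hc.dvd_of_dvd_mul_left
  have h1 : (Int.gcd a M : ℤ) ∣ a := Int.gcd_dvd_left ..
  have h2 : (Int.gcd a M : ℤ) ∣ M := Int.gcd_dvd_right ..
  have hg' : (Int.gcd a M : ℤ) ≠ 0 := by exact_mod_cast hg.ne'
  rw [← mul_dvd_mul_iff_left hg', Int.mul_ediv_cancel' h2, ← mul_assoc, Int.mul_ediv_cancel' h1]
  exact h

/-- M divides (XV - UY)(XV + UY) = M(V² - Y²). With d the gcd of XV - UY and M, and k = M/d, the
point (X, Y) is proportional to (U, V) mod d and to (U, -V) mod k. Two points with the same d are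
therefore proportional to each other mod d and mod k, hence mod their lcm. The gcd of d and k
divides 2XV and is coprime to X and V, so the loss is at most 2. -/
theorem dvd_two_mul_cross {D M X Y X' Y' U V : ℤ} (hM : 0 < M)
    (hsq : ∀ l : ℤ, Prime l → l ^ 2 ∣ D → l ^ 2 ∣ M → False)
    (h0 : U ^ 2 + D * V ^ 2 = M) (hcop0 : IsCoprime U V)
    (h : X ^ 2 + D * Y ^ 2 = M) (hcop : IsCoprime X Y)
    (h' : X' ^ 2 + D * Y' ^ 2 = M)
    (hg : Int.gcd (X * V - U * Y) M = Int.gcd (X' * V - U * Y') M) :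
    M ∣ 2 * (X * Y' - X' * Y) := by
  set d : ℤ := (Int.gcd (X * V - U * Y) M : ℤ) with hd
  have hdM : d ∣ M := Int.gcd_dvd_right ..
  obtain ⟨k, hk⟩ := hdM
  have hd0 : d ≠ 0 := by rintro h; rw [h] at hk; simp at hk; exact hM.ne' hk
  have hkd : M / d = k := by rw [hk]; exact Int.mul_ediv_cancel_left _ hd0
  have m1 : k ∣ X * V + U * Y := by
    rw [← hkd]
    apply dvd_of_div_gcd hM
    exact ⟨V ^ 2 - Y ^ 2, by linear_combination V ^ 2 * h - Y ^ 2 * h0⟩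
  have m1' : k ∣ X' * V + U * Y' := by
    rw [← hkd, hd, hg]
    apply dvd_of_div_gcd hM
    exact ⟨V ^ 2 - Y' ^ 2, by linear_combination V ^ 2 * h' - Y' ^ 2 * h0⟩
  have m2 : d ∣ X * V - U * Y := Int.gcd_dvd_left ..
  have m2' : d ∣ X' * V - U * Y' := by rw [hd, hg]; exact Int.gcd_dvd_left ..
  have hVM : IsCoprime V M := by
    rw [← h0]
    have : IsCoprime V (U ^ 2) := (hcop0.symm).pow_right
    have := this.add_mul_left_right (D * V)
    rwa [show U ^ 2 + V * (D * V) = U ^ 2 + D * V ^ 2 by ring] at this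
  have hkM : k ∣ M := ⟨d, by rw [hk]; ring⟩
  have hdM : d ∣ M := ⟨k, hk⟩
  have c1 : d ∣ X * Y' - X' * Y := by
    apply (hVM.of_isCoprime_of_dvd_right hdM).symm.dvd_of_dvd_mul_left
    have : V * (X * Y' - X' * Y) = (X * V - U * Y) * Y' - (X' * V - U * Y') * Y := by ring
    rw [this]
    exact dvd_sub (m2.mul_right _) (m2'.mul_right _)
  have c2 : k ∣ X * Y' - X' * Y := by
    apply (hVM.of_isCoprime_of_dvd_right hkM).symm.dvd_of_dvd_mul_left
    have : V * (X * Y' - X' * Y) = (X * V + U * Y) * Y' - (X' * V + U * Y') * Y := by ring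
    rw [this]
    exact dvd_sub (m1.mul_right _) (m1'.mul_right _)
  set g : ℤ := (Int.gcd d k : ℤ) with hgdef
  have gd : g ∣ d := Int.gcd_dvd_left ..
  have gk : g ∣ k := Int.gcd_dvd_right ..
  -- A prime l dividing g and X gives l² ∣ dk = M and l² ∣ DY², hence l² ∣ D since Y is prime to X.
  -- This is what `hsq` excludes.
  have gX : IsCoprime g X := by
    rw [Int.isCoprime_iff_gcd_eq_one]
    by_contra hne
    obtain ⟨l, hl, hlg⟩ := Nat.exists_prime_and_dvd hne
    have hl' : Prime (l : ℤ) := Nat.prime_iff_prime_int.mp hl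
    have hlg' : (l : ℤ) ∣ (Int.gcd g X : ℤ) := by exact_mod_cast hlg
    have l1 : (l : ℤ) ∣ g := hlg'.trans (Int.gcd_dvd_left ..)
    have l2 : (l : ℤ) ∣ X := hlg'.trans (Int.gcd_dvd_right ..)
    have l3 : (l : ℤ) ^ 2 ∣ M := by
      rw [hk, sq]; exact mul_dvd_mul (l1.trans gd) (l1.trans gk)
    have l4 : (l : ℤ) ^ 2 ∣ D * Y ^ 2 := by
      have : D * Y ^ 2 = M - X ^ 2 := by linarith
      rw [this]; exact dvd_sub l3 (pow_dvd_pow_of_dvd l2 2)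
    have l5 : IsCoprime ((l : ℤ) ^ 2) (Y ^ 2) := (hcop.of_isCoprime_of_dvd_left l2).pow
    exact hsq l hl' (l5.dvd_of_dvd_mul_right l4) l3
  have g2 : g ∣ 2 := by
    have a1 : g ∣ V * (X * 2) := by
      have : V * (X * 2) = (X * V - U * Y) + (X * V + U * Y) := by ring
      rw [this]; exact dvd_add (gd.trans m2) (gk.trans m1)
    have a2 : g ∣ X * 2 :=
      (hVM.of_isCoprime_of_dvd_right (gd.trans hdM)).symm.dvd_of_dvd_mul_left a1
    exact gX.dvd_of_dvd_mul_left a2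
  have hlcm : (Int.lcm d k : ℤ) ∣ X * Y' - X' * Y := Int.coe_lcm_dvd c1 c2
  have hM' : M ∣ g * (Int.lcm d k : ℤ) := by
    have := Int.gcd_mul_lcm d k
    have h3 : g * (Int.lcm d k : ℤ) = ((d * k).natAbs : ℤ) := by rw [hgdef, Int.natAbs_mul]; exact_mod_cast this
    rw [h3, ← hk]; exact Int.dvd_natAbs.mpr dvd_rfl
  exact hM'.trans (mul_dvd_mul g2 hlcm)

/-- Classify the points by the gcd of M with their cross product against a fixed point w; there are
at most d(M) classes. Within a class, the cross product with a fixed member u is a multiple of M/2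
of modulus at most M. That leaves five values, times two signs of the dot product, and these data
determine the point. -/
theorem card_ellipse_of_squarefree {D M : ℤ} (hD : 0 < D) (hM : 0 < M)
    (hsq : ∀ l : ℤ, Prime l → l ^ 2 ∣ D → l ^ 2 ∣ M → False) (S : Finset (ℤ × ℤ))
    (hS : ∀ v ∈ S, v.1 ^ 2 + D * v.2 ^ 2 = M) (hcop : ∀ v ∈ S, IsCoprime v.1 v.2) :
    S.card ≤ 10 * M.natAbs.divisors.card := by
  classical
  rcases S.eq_empty_or_nonempty with rfl | ⟨w, hw⟩
  · simp
  let f : ℤ × ℤ → ℕ := fun v => Int.gcd (v.1 * w.2 - w.1 * v.2) M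
  have himg : (S.image f).card ≤ M.natAbs.divisors.card := by
    apply Finset.card_le_card
    intro d hd
    obtain ⟨v, -, rfl⟩ := Finset.mem_image.mp hd
    rw [Nat.mem_divisors]
    exact ⟨Nat.gcd_dvd_right _ _, by simpa using hM.ne'⟩
  refine (Finset.card_le_mul_card_image (f := f) S 10 ?_).trans (by gcongr)
  intro d hd
  obtain ⟨u, hu, rfl⟩ := Finset.mem_image.mp hd
  let h : ℤ × ℤ → ℤ × Bool := fun v =>
    (2 * (v.1 * u.2 - u.1 * v.2) / M, decide (0 ≤ v.1 * u.1 + D * v.2 * u.2))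
  have hmul : ∀ v ∈ S.filter (fun v => f v = f u),
      2 * (v.1 * u.2 - u.1 * v.2) = M * (2 * (v.1 * u.2 - u.1 * v.2) / M) := by
    intro v hv
    rw [Finset.mem_filter] at hv
    exact (Int.mul_ediv_cancel' (dvd_two_mul_cross hM hsq (hS w hw) (hcop w hw) (hS v hv.1)
      (hcop v hv.1) (hS u hu) hv.2)).symm
  have hcard : ((Finset.Icc (-2 : ℤ) 2) ×ˢ (Finset.univ : Finset Bool)).card = 10 := by
    simp
  rw [← hcard]
  apply Finset.card_le_card_of_injOn h
  · intro v hv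
    have hv' := hv
    simp only [Finset.coe_filter, Set.mem_ofPred_eq] at hv'
    have e := hmul v hv
    have e1 := hS v hv'.1
    have e2 := hS u hu
    simp only [h, Finset.coe_product, Set.mem_prod, Finset.coe_Icc, Set.mem_Icc,
      Finset.coe_univ, Set.mem_univ, and_true]
    set k := 2 * (v.1 * u.2 - u.1 * v.2) / M
    have id : (v.1 * u.1 + D * v.2 * u.2) ^ 2 + D * (v.1 * u.2 - u.1 * v.2) ^ 2 = M ^ 2 := by
      rw [sq M]; nth_rewrite 1 [← e1]; rw [← e2]; ring
    have b1 : (v.1 * u.2 - u.1 * v.2) ^ 2 ≤ M ^ 2 := by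
      nlinarith [sq_nonneg (v.1 * u.1 + D * v.2 * u.2), sq_nonneg (v.1 * u.2 - u.1 * v.2)]
    have b2 : M ^ 2 * k ^ 2 ≤ M ^ 2 * 2 ^ 2 := by
      have : M ^ 2 * k ^ 2 = 4 * (v.1 * u.2 - u.1 * v.2) ^ 2 := by
        rw [← mul_pow, ← e]; ring
      rw [this]; linarith
    have b3 : k ^ 2 ≤ 2 ^ 2 := le_of_mul_le_mul_left b2 (by positivity)
    exact abs_le.mp (abs_le_of_sq_le_sq b3 (by norm_num))
  · intro v hv v' hv' hvv
    have e := hmul v hv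
    have e' := hmul v' hv'
    simp only [Finset.coe_filter, Set.mem_ofPred_eq] at hv hv'
    simp only [h, Prod.mk.injEq, decide_eq_decide] at hvv
    rw [hvv.1, ← e'] at e
    have := ellipse_eq_of_cross_eq hM (hS u hu) (hS v hv.1) (hS v' hv'.1) (by linarith) hvv.2
    exact Prod.ext this.1 this.2

/-- Let b² be the largest square dividing gcd(D, M). Then b ∣ X, and replacing X, D, M by X/b, D/b²,
M/b² removes every common prime square while keeping the points primitive. -/
theorem card_ellipse_of_coprime {D M : ℤ} (hD : 0 < D) (hM : 0 < M) (S : Finset (ℤ × ℤ))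
    (hS : ∀ v ∈ S, v.1 ^ 2 + D * v.2 ^ 2 = M) (hcop : ∀ v ∈ S, IsCoprime v.1 v.2) :
    S.card ≤ 10 * M.natAbs.divisors.card := by
  classical
  obtain ⟨a, b, hab, ha⟩ := Nat.sq_mul_squarefree (Int.gcd D M)
  have hg : 0 < Int.gcd D M := Int.gcd_pos_of_ne_zero_right _ hM.ne'
  have hb0 : b ≠ 0 := by rintro rfl; simp at hab; omega
  have hb : (0 : ℤ) < b := by positivity
  have hbg : ((b : ℤ) ^ 2) ∣ (Int.gcd D M : ℤ) := ⟨a, by exact_mod_cast hab.symm⟩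
  obtain ⟨D', hD'⟩ := hbg.trans (Int.gcd_dvd_left (a := D) (b := M))
  obtain ⟨M', hM'⟩ := hbg.trans (Int.gcd_dvd_right (a := D) (b := M))
  have hb2 : (0 : ℤ) < (b : ℤ) ^ 2 := by positivity
  have hD0 : 0 < D' := by rw [hD'] at hD; exact pos_of_mul_pos_right hD hb2.le
  have hM0 : 0 < M' := by rw [hM'] at hM; exact pos_of_mul_pos_right hM hb2.le
  have hsq : ∀ l : ℤ, Prime l → l ^ 2 ∣ D' → l ^ 2 ∣ M' → False := by
    intro l hl h1 h2
    have h3 : (b : ℤ) ^ 2 * l ^ 2 ∣ (Int.gcd D M : ℤ) :=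
      Int.dvd_coe_gcd (hD' ▸ mul_dvd_mul_left _ h1) (hM' ▸ mul_dvd_mul_left _ h2)
    have h4 : l ^ 2 ∣ (a : ℤ) := by
      rw [← hab] at h3; push_cast at h3
      exact (mul_dvd_mul_iff_left hb2.ne').mp h3
    have h5 : Squarefree (a : ℤ) := Int.squarefree_natCast.mpr ha
    exact hl.not_isUnit (h5 l (by rw [← sq]; exact h4))
  have hbX : ∀ v ∈ S, (b : ℤ) ∣ v.1 := by
    intro v hv
    have : (b : ℤ) ^ 2 ∣ v.1 ^ 2 := by
      have h1 : v.1 ^ 2 = b ^ 2 * (M' - D' * v.2 ^ 2) := by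
        have := hS v hv; rw [hD', hM'] at this; linarith
      exact ⟨_, h1⟩
    exact (Int.pow_dvd_pow_iff two_ne_zero).mp this
  have hinj : Set.InjOn (fun v : ℤ × ℤ => (v.1 / (b : ℤ), v.2)) S := by
    intro v hv w hw hvw
    simp only [Prod.mk.injEq] at hvw
    refine Prod.ext ?_ hvw.2
    rw [← Int.mul_ediv_cancel' (hbX v hv), ← Int.mul_ediv_cancel' (hbX w hw), hvw.1]
  rw [← Finset.card_image_of_injOn hinj]
  refine (card_ellipse_of_squarefree hD0 hM0 hsq _ ?_ ?_).trans ?_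
  · intro v hv
    obtain ⟨w, hw, rfl⟩ := Finset.mem_image.mp hv
    obtain ⟨x, hx⟩ := hbX w hw
    have := hS w hw
    simp only [hx, Int.mul_ediv_cancel_left _ hb.ne']
    rw [hx, hD', hM'] at this
    apply mul_left_cancel₀ hb2.ne'
    linarith
  · intro v hv
    obtain ⟨w, hw, rfl⟩ := Finset.mem_image.mp hv
    have := hcop w hw
    obtain ⟨x, hx⟩ := hbX w hw
    simp only [hx, Int.mul_ediv_cancel_left _ hb.ne']
    exact this.of_isCoprime_of_dvd_left ⟨b, by rw [hx]; ring⟩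
  · gcongr
    · exact Int.natAbs_dvd_natAbs.mpr ⟨b ^ 2, by rw [hM']; ring⟩

/-- The number of integer points of the ellipse `X² + D Y² = M` is at most `10 d(M)²`. -/
theorem card_ellipse_le {D M : ℤ} (hD : 0 < D) (hM : 0 < M) (S : Finset (ℤ × ℤ))
    (hS : ∀ v ∈ S, v.1 ^ 2 + D * v.2 ^ 2 = M) :
    S.card ≤ 10 * M.natAbs.divisors.card ^ 2 := by
  classical
  let f : ℤ × ℤ → ℕ := fun v => Int.gcd v.1 v.2
  -- The gcd g of the coordinates has g² ∣ M, so it takes at most d(M) values. Dividing by g leaves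
  -- primitive points for M/g².
  have hgM : ∀ v ∈ S, ((f v : ℤ)) ^ 2 ∣ M := by
    intro v hv
    rw [← hS v hv]
    exact dvd_add (pow_dvd_pow_of_dvd (Int.gcd_dvd_left ..) 2)
      ((pow_dvd_pow_of_dvd (Int.gcd_dvd_right ..) 2).mul_left _)
  have himg : (S.image f).card ≤ M.natAbs.divisors.card := by
    apply Finset.card_le_card
    intro d hd
    obtain ⟨v, hv, rfl⟩ := Finset.mem_image.mp hd
    rw [Nat.mem_divisors]
    refine ⟨?_, by simpa using hM.ne'⟩
    have := (Dvd.intro_left _ (sq (f v : ℤ)).symm : (f v : ℤ) ∣ (f v : ℤ) ^ 2).trans (hgM v hv)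
    exact Int.natCast_dvd.mp this
  rw [sq, ← mul_assoc]
  refine (Finset.card_le_mul_card_image (f := f) S (10 * M.natAbs.divisors.card) ?_).trans
    (by gcongr)
  intro d hd
  obtain ⟨u, hu, rfl⟩ := Finset.mem_image.mp hd
  obtain ⟨M', hM'⟩ := hgM u hu
  have hg0 : (f u : ℤ) ≠ 0 := by
    intro h; rw [h] at hM'; simp at hM'; omega
  have hg1 : 0 < f u := Nat.pos_of_ne_zero (by exact_mod_cast hg0)
  have hg2 : (0 : ℤ) < (f u : ℤ) ^ 2 := by positivity
  have hM0 : 0 < M' := by rw [hM'] at hM; exact pos_of_mul_pos_right hM hg2.le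
  have hdiv : ∀ v ∈ S.filter (fun v => f v = f u),
      v.1 = f u * (v.1 / f u) ∧ v.2 = f u * (v.2 / f u) := by
    intro v hv
    rw [Finset.mem_filter] at hv
    rw [← hv.2]
    exact ⟨(Int.mul_ediv_cancel' (Int.gcd_dvd_left ..)).symm,
      (Int.mul_ediv_cancel' (Int.gcd_dvd_right ..)).symm⟩
  have hinj : Set.InjOn (fun v : ℤ × ℤ => (v.1 / (f u : ℤ), v.2 / (f u : ℤ)))
      (S.filter (fun v => f v = f u)) := by
    intro v hv w hw hvw
    simp only [Prod.mk.injEq] at hvw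
    have h1 := hdiv v hv
    have h2 := hdiv w hw
    exact Prod.ext (by rw [h1.1, h2.1, hvw.1]) (by rw [h1.2, h2.2, hvw.2])
  rw [← Finset.card_image_of_injOn hinj]
  refine (card_ellipse_of_coprime hD hM0 _ ?_ ?_).trans ?_
  · intro v hv
    obtain ⟨w, hw, rfl⟩ := Finset.mem_image.mp hv
    have h1 := hdiv w hw
    have := hS w (Finset.mem_filter.mp hw).1
    simp only
    apply mul_left_cancel₀ hg2.ne'
    rw [← hM', ← this]
    generalize w.1 / (f u : ℤ) = x at h1
    generalize w.2 / (f u : ℤ) = y at h1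
    rw [h1.1, h1.2]
    ring
  · intro v hv
    obtain ⟨w, hw, rfl⟩ := Finset.mem_image.mp hv
    rw [Finset.mem_filter] at hw
    rw [← hw.2, Int.isCoprime_iff_gcd_eq_one]
    exact Int.gcd_ediv_gcd_ediv_gcd (by show 0 < f w; rw [hw.2]; exact hg1)
  · gcongr
    · exact Int.natAbs_dvd_natAbs.mpr ⟨(f u : ℤ) ^ 2, by rw [hM']; ring⟩

/-! ### Lattice points near a circle through the origin. -/

/-- The cross product of two integer vectors. -/
def intCross (v w : ℤ × ℤ) : ℤ := v.1 * w.2 - v.2 * w.1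

/-- The determinant with rows `(m², m, n)` for three integer vectors `(m, n)`. -/
def detSqFst (u v w : ℤ × ℤ) : ℤ :=
  u.1 ^ 2 * intCross v w + v.1 ^ 2 * intCross w u + w.1 ^ 2 * intCross u v

/-- The determinant with rows `(n², m, n)` for three integer vectors `(m, n)`. -/
def detSqSnd (u v w : ℤ × ℤ) : ℤ :=
  u.2 ^ 2 * intCross v w + v.2 ^ 2 * intCross w u + w.2 ^ 2 * intCross u v

/-- After rescaling, `(m, n)` is a lattice vector in a thin neighbourhood of a unit circle through
the origin centred at `(a, b)`. -/
structure NearCircle (A a b e : ℝ) (v : ℤ × ℤ) : Prop where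
  fst_le : |(v.1 : ℝ)| ≤ 3 * A
  snd_le : |(v.2 : ℝ)| ≤ 3 * A ^ 2
  near : |A ^ 2 * (v.1 : ℝ) ^ 2 + (v.2 : ℝ) ^ 2 - 2 * a * A ^ 3 * v.1 - 2 * b * A ^ 2 * v.2|
    ≤ e * A ^ 4

section
variable {A a b e : ℝ}

theorem abs_intCross_le (hA : 1 ≤ A) {v w : ℤ × ℤ} (hv : NearCircle A a b e v)
    (hw : NearCircle A a b e w) : |(intCross v w : ℝ)| ≤ 18 * A ^ 3 := by
  rw [intCross]; push_cast
  calc |(v.1 : ℝ) * w.2 - v.2 * w.1| ≤ |(v.1 : ℝ) * w.2| + |(v.2 : ℝ) * w.1| := abs_sub _ _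
    _ = |(v.1 : ℝ)| * |(w.2 : ℝ)| + |(v.2 : ℝ)| * |(w.1 : ℝ)| := by rw [abs_mul, abs_mul]
    _ ≤ (3 * A) * (3 * A ^ 2) + (3 * A ^ 2) * (3 * A) := by
      gcongr
      exacts [hv.fst_le, hw.snd_le, hv.snd_le, hw.fst_le]
    _ = 18 * A ^ 3 := by ring

/-- Expand the determinant with rows (F, m, n), where F is the form bounded in `NearCircle`. The
terms of F linear in m and n are multiples of the other columns, so the unknown centre (a, b) drops
out. -/
theorem abs_det_comb_le (hA : 1 ≤ A) (he : 0 ≤ e) {u v w : ℤ × ℤ} (hu : NearCircle A a b e u)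
    (hv : NearCircle A a b e v) (hw : NearCircle A a b e w) :
    |A ^ 2 * (detSqFst u v w : ℝ) + detSqSnd u v w| ≤ 54 * e * A ^ 7 := by
  have c1 := abs_intCross_le hA hv hw
  have c2 := abs_intCross_le hA hw hu
  have c3 := abs_intCross_le hA hu hv
  set F : ℤ × ℤ → ℝ := fun v =>
    A ^ 2 * (v.1 : ℝ) ^ 2 + (v.2 : ℝ) ^ 2 - 2 * a * A ^ 3 * v.1 - 2 * b * A ^ 2 * v.2 with hF
  have id : A ^ 2 * (detSqFst u v w : ℝ) + detSqSnd u v w =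
      F u * intCross v w + F v * intCross w u + F w * intCross u v := by
    simp only [hF, detSqFst, detSqSnd, intCross]; push_cast; ring
  rw [id]
  calc _ ≤ |F u * intCross v w| + |F v * intCross w u| + |F w * intCross u v| :=
        abs_add_three _ _ _
    _ = |F u| * |(intCross v w : ℝ)| + |F v| * |(intCross w u : ℝ)| +
          |F w| * |(intCross u v : ℝ)| := by simp only [abs_mul]
    _ ≤ e * A ^ 4 * (18 * A ^ 3) + e * A ^ 4 * (18 * A ^ 3) + e * A ^ 4 * (18 * A ^ 3) := by
      gcongr
      exacts [hu.near, hv.near, hw.near]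
    _ = _ := by ring

theorem abs_detSqFst_le (hA : 1 ≤ A) {u v w : ℤ × ℤ} (hu : NearCircle A a b e u)
    (hv : NearCircle A a b e v) (hw : NearCircle A a b e w) :
    |(detSqFst u v w : ℝ)| ≤ 486 * A ^ 5 := by
  have c1 := abs_intCross_le hA hv hw
  have c2 := abs_intCross_le hA hw hu
  have c3 := abs_intCross_le hA hu hv
  rw [detSqFst]; push_cast
  calc _ ≤ |(u.1 : ℝ) ^ 2 * intCross v w| + |(v.1 : ℝ) ^ 2 * intCross w u| +
          |(w.1 : ℝ) ^ 2 * intCross u v| := abs_add_three _ _ _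
    _ = |(u.1 : ℝ)| ^ 2 * |(intCross v w : ℝ)| + |(v.1 : ℝ)| ^ 2 * |(intCross w u : ℝ)| +
          |(w.1 : ℝ)| ^ 2 * |(intCross u v : ℝ)| := by simp only [abs_mul, abs_pow]
    _ ≤ (3 * A) ^ 2 * (18 * A ^ 3) + (3 * A) ^ 2 * (18 * A ^ 3) + (3 * A) ^ 2 * (18 * A ^ 3) := by
      gcongr
      exacts [hu.fst_le, hv.fst_le, hw.fst_le]
    _ = _ := by ring

/-- If the neighbourhood is thin enough, all determinants satisfy one common linear relation with
small positive integer coefficients. -/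
theorem exists_relation (hA : 1 ≤ A) (he : 0 ≤ e) (heA : e * A ^ 12 ≤ 1 / 60000)
    (S : Finset (ℤ × ℤ)) (hS : ∀ v ∈ S, NearCircle A a b e v) :
    ∃ p q : ℤ, 0 < p ∧ 0 < q ∧ (p : ℝ) ≤ 500 * A ^ 7 ∧ (q : ℝ) ≤ 500 * A ^ 7 ∧
      ∀ u ∈ S, ∀ v ∈ S, ∀ w ∈ S, p * detSqFst u v w + q * detSqSnd u v w = 0 := by
  have hA7 : 1 ≤ A ^ 7 := one_le_pow₀ hA
  have hA57 : A ^ 5 ≤ A ^ 7 := pow_le_pow_right₀ hA (by norm_num)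
  have he7 : e * A ^ 7 ≤ 1 / 60000 :=
    (mul_le_mul_of_nonneg_left (pow_le_pow_right₀ hA (by norm_num)) he).trans heA
  by_cases h : ∃ u ∈ S, ∃ v ∈ S, ∃ w ∈ S, detSqFst u v w ≠ 0
  · obtain ⟨u, hu, v, hv, w, hw, hne⟩ := h
    set P := detSqFst u v w
    set B := detSqSnd u v w
    have hP1 : (1 : ℝ) ≤ |(P : ℝ)| := by exact_mod_cast Int.one_le_abs hne
    have hP := abs_detSqFst_le hA (hS u hu) (hS v hv) (hS w hw)
    have hPB := abs_det_comb_le hA he (hS u hu) (hS v hv) (hS w hw)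
    -- A 2×2 minor of two pairs of determinants is an integer. Both pairs nearly satisfy A²P + B =
    -- 0, so it is O(e A^12) < 1 and vanishes.
    have hrel : ∀ u' ∈ S, ∀ v' ∈ S, ∀ w' ∈ S,
        P * detSqSnd u' v' w' - detSqFst u' v' w' * B = 0 := by
      intro u' hu' v' hv' w' hw'
      have hP' := abs_detSqFst_le hA (hS u' hu') (hS v' hv') (hS w' hw')
      have hPB' := abs_det_comb_le hA he (hS u' hu') (hS v' hv') (hS w' hw')
      rw [← Int.abs_lt_one_iff]
      have : |((P * detSqSnd u' v' w' - detSqFst u' v' w' * B : ℤ) : ℝ)| < 1 := by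
        push_cast
        have id : (P : ℝ) * detSqSnd u' v' w' - detSqFst u' v' w' * B =
            P * (A ^ 2 * detSqFst u' v' w' + detSqSnd u' v' w') -
            detSqFst u' v' w' * (A ^ 2 * P + B) := by ring
        rw [id]
        refine (abs_sub _ _).trans_lt ?_
        rw [abs_mul, abs_mul]
        calc _ ≤ (486 * A ^ 5) * (54 * e * A ^ 7) + (486 * A ^ 5) * (54 * e * A ^ 7) := by
              gcongr
          _ = 52488 * (e * A ^ 12) := by ring
          _ < 1 := by linarith
      exact_mod_cast this
    have hB1 : |(B : ℝ)| ≤ 500 * A ^ 7 := by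
      calc |(B : ℝ)| = |(A ^ 2 * P + B) - A ^ 2 * P| := by ring_nf
        _ ≤ |A ^ 2 * (P : ℝ) + B| + |A ^ 2 * (P : ℝ)| := abs_sub _ _
        _ = |A ^ 2 * (P : ℝ) + B| + A ^ 2 * |(P : ℝ)| := by
          rw [abs_mul, abs_of_nonneg (by positivity : (0 : ℝ) ≤ A ^ 2)]
        _ ≤ 54 * e * A ^ 7 + A ^ 2 * (486 * A ^ 5) := by gcongr
        _ = 54 * (e * A ^ 7) + 486 * A ^ 7 := by ring
        _ ≤ _ := by linarith
    -- B is within distance 1 of -A²P, and P is a nonzero integer; the opposite signs make both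
    -- coefficients positive, so the conic is an ellipse.
    have hsign : P * B < 0 := by
      have h1 : (P : ℝ) * (A ^ 2 * P + B) < A ^ 2 * P ^ 2 := by
        calc (P : ℝ) * (A ^ 2 * P + B) ≤ |(P : ℝ)| * |A ^ 2 * (P : ℝ) + B| := by
              rw [← abs_mul]; exact le_abs_self _
          _ ≤ |(P : ℝ)| * (54 * e * A ^ 7) := by gcongr
          _ < |(P : ℝ)| * 1 := by
            apply mul_lt_mul_of_pos_left _ (by linarith)
            linarith
          _ ≤ |(P : ℝ)| * |(P : ℝ)| := by gcongr
          _ = 1 * (P : ℝ) ^ 2 := by rw [← sq, sq_abs, one_mul]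
          _ ≤ A ^ 2 * P ^ 2 := by gcongr; exact one_le_pow₀ hA
      have h2 : (P : ℝ) * B < 0 := by linarith
      exact_mod_cast h2
    have hB0 : B ≠ 0 := by rintro h; rw [h] at hsign; simp at hsign
    refine ⟨|B|, |P|, abs_pos.mpr hB0, abs_pos.mpr hne, by push_cast; exact hB1,
      by push_cast; linarith, ?_⟩
    intro u' hu' v' hv' w' hw'
    have := hrel u' hu' v' hv' w' hw'
    rcases mul_neg_iff.mp hsign with ⟨h1, h2⟩ | ⟨h1, h2⟩
    · rw [abs_of_pos h1, abs_of_neg h2]; linarith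
    · rw [abs_of_neg h1, abs_of_pos h2]; linarith
  · push Not at h
    refine ⟨1, 1, one_pos, one_pos, by push_cast; linarith, by push_cast; linarith, ?_⟩
    intro u hu v hv w hw
    have h1 := h u hu v hv w hw
    have h2 := abs_det_comb_le hA he (hS u hu) (hS v hv) (hS w hw)
    rw [h1] at h2 ⊢
    have h3 : |(detSqSnd u v w : ℝ)| < 1 := by
      simp only [Int.cast_zero, mul_zero, zero_add] at h2
      linarith
    have h4 : detSqSnd u v w = 0 := by
      rw [← Int.abs_lt_one_iff]; exact_mod_cast h3
    rw [h4]; ring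

/-- A line through the origin carries at most one nonzero point of the neighbourhood. -/
theorem eq_of_intCross_eq_zero (hA : 1 ≤ A) (he : 0 ≤ e) (heA : e * A ^ 12 ≤ 1 / 60000)
    {v w : ℤ × ℤ} (hv : NearCircle A a b e v) (hw : NearCircle A a b e w) (hv0 : v ≠ 0)
    (hw0 : w ≠ 0) (hc : intCross v w = 0) : v = w := by
  obtain ⟨m, n⟩ := v
  obtain ⟨m', n'⟩ := w
  have he6 : e * A ^ 6 ≤ 1 / 60000 :=
    (mul_le_mul_of_nonneg_left (pow_le_pow_right₀ hA (by norm_num)) he).trans heA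
  simp only [intCross] at hc
  have hcR : (m : ℝ) * n' - n * m' = 0 := by exact_mod_cast hc
  have hA12 : A ≤ A ^ 2 := by nlinarith
  obtain ⟨hm, hn, hv'⟩ := hv
  obtain ⟨hm', hn', hw'⟩ := hw
  simp only at hm hn hv' hm' hn' hw'
  set F := A ^ 2 * (m : ℝ) ^ 2 + (n : ℝ) ^ 2 - 2 * a * A ^ 3 * m - 2 * b * A ^ 2 * n with hF
  set F' := A ^ 2 * (m' : ℝ) ^ 2 + (n' : ℝ) ^ 2 - 2 * a * A ^ 3 * m' - 2 * b * A ^ 2 * n' with hF'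
  -- Used with (x, y) = (n, n') or (m, m'). Since the vectors are parallel, the linear terms cancel
  -- in x F' - y F, leaving (x, y) times a quadratic expression free of a and b.
  have small : ∀ x y : ℝ, |x| ≤ 3 * A ^ 2 → |y| ≤ 3 * A ^ 2 → |x * F' - y * F| < 1 := by
    intro x y hx hy
    refine (abs_sub _ _).trans_lt ?_
    rw [abs_mul, abs_mul]
    calc _ ≤ (3 * A ^ 2) * (e * A ^ 4) + (3 * A ^ 2) * (e * A ^ 4) := by gcongr
      _ = 6 * (e * A ^ 6) := by ring
      _ < 1 := by linarith
  by_cases hm0 : m = 0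
  · subst hm0
    have hn0 : n ≠ 0 := by rintro rfl; exact hv0 rfl
    have hm'0 : m' = 0 := by
      have : n * m' = 0 := by linarith
      exact (mul_eq_zero.mp this).resolve_left hn0
    subst hm'0
    have hn'0 : n' ≠ 0 := by rintro rfl; exact hw0 rfl
    have h1 := small n n' hn hn'
    have h2 : (n : ℝ) * F' - n' * F = ((n * n' * (n' - n) : ℤ) : ℝ) := by
      rw [hF, hF']; push_cast; ring
    rw [h2] at h1
    have h3 : n * n' * (n' - n) = 0 := by rw [← Int.abs_lt_one_iff]; exact_mod_cast h1
    have h4 : n' - n = 0 := (mul_eq_zero.mp h3).resolve_left (mul_ne_zero hn0 hn'0)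
    have : n = n' := by linarith
    rw [this]
  · have hm'0 : m' ≠ 0 := by
      rintro rfl
      have : m * n' = 0 := by linarith
      have := (mul_eq_zero.mp this).resolve_left hm0
      subst this; exact hw0 rfl
    have h1 := small m m' (hm.trans (by linarith)) (hm'.trans (by linarith))
    have h2 : (m : ℝ) * F' - m' * F = (m' - m) * (A ^ 2 * (m * m') + n * n') := by
      rw [hF, hF']
      linear_combination (n' - 2 * b * A ^ 2 + n) * hcR
    by_cases hmm : m = m'
    · subst hmm
      have : m * (n' - n) = 0 := by linarith
      have := (mul_eq_zero.mp this).resolve_left hm0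
      have : n = n' := by linarith
      rw [this]
    · exfalso
      -- Parallelism gives m(A²mm' + nn') = m'(A²m² + n²), which bounds the second factor below by 1
      -- and contradicts smallness.
      have h3 : (m : ℝ) * (n * n') = m' * n ^ 2 := by linear_combination n * hcR
      have hmm' : (1 : ℝ) ≤ |((m' - m : ℤ) : ℝ)| := by
        have : m' - m ≠ 0 := by intro h; apply hmm; linarith
        exact_mod_cast Int.one_le_abs this
      have hm1 : (1 : ℝ) ≤ |(m : ℝ)| := by exact_mod_cast Int.one_le_abs hm0
      have hm'1 : (1 : ℝ) ≤ |(m' : ℝ)| := by exact_mod_cast Int.one_le_abs hm'0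
      have h4 : |(m : ℝ)| * |A ^ 2 * ((m : ℝ) * m') + n * n'| =
          |(m' : ℝ)| * (A ^ 2 * m ^ 2 + n ^ 2) := by
        rw [← abs_of_nonneg (by positivity : (0 : ℝ) ≤ A ^ 2 * m ^ 2 + n ^ 2), ← abs_mul,
          ← abs_mul]
        congr 1
        linear_combination h3
      have h5 : |(m : ℝ)| * |A ^ 2 * ((m : ℝ) * m') + n * n'| ≥ |(m : ℝ)| * 1 := by
        rw [h4]
        calc |(m' : ℝ)| * (A ^ 2 * m ^ 2 + n ^ 2) ≥ 1 * (1 * m ^ 2 + 0) := by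
              gcongr
              · exact one_le_pow₀ hA
              · positivity
          _ = |(m : ℝ)| * |(m : ℝ)| := by rw [← sq, sq_abs]; ring
          _ ≥ _ := by gcongr
      have h6 : 1 ≤ |A ^ 2 * ((m : ℝ) * m') + n * n'| := le_of_mul_le_mul_left h5 (by linarith)
      rw [h2, abs_mul] at h1
      have : (1 : ℝ) ≤ |(m' : ℝ) - m| := by exact_mod_cast hmm'
      nlinarith

/-- With x and y fixed and not parallel, the relation becomes a conic c(pm² + qn²) + βm + γn = 0 for
every v = (m, n) in S, with c ≠ 0. Multiplying by 4cpq² and completing squares maps S injectively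
into the points of X² + pqY² = M. -/
theorem card_le_of_relation {B : ℝ} (hB : 1 ≤ B) {p q : ℤ} (hp : 0 < p) (hq : 0 < q)
    (hpB : (p : ℝ) ≤ B) (hqB : (q : ℝ) ≤ B) (S : Finset (ℤ × ℤ))
    (hSB : ∀ v ∈ S, |(v.1 : ℝ)| ≤ B ∧ |(v.2 : ℝ)| ≤ B)
    {x y : ℤ × ℤ} (hx : x ∈ S) (hy : y ∈ S) (hxy : intCross x y ≠ 0)
    (hrel : ∀ v ∈ S, p * detSqFst x y v + q * detSqSnd x y v = 0) :
    ∃ M : ℕ, M ≠ 0 ∧ (M : ℝ) ≤ 32 * B ^ 10 ∧ S.card ≤ 10 * M.divisors.card ^ 2 := by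
  set c := intCross x y with hc
  set Q : ℤ × ℤ → ℤ := fun v => p * v.1 ^ 2 + q * v.2 ^ 2 with hQ
  set β := Q y * x.2 - Q x * y.2 with hβ
  set γ := Q x * y.1 - Q y * x.1 with hγ
  have heq : ∀ v ∈ S, c * (p * v.1 ^ 2 + q * v.2 ^ 2) + β * v.1 + γ * v.2 = 0 := by
    intro v hv
    rw [← hrel v hv]
    simp only [hc, hβ, hγ, hQ, detSqFst, detSqSnd, intCross]; ring
  set M := q * (q * β ^ 2 + p * γ ^ 2) with hM
  have hM0 : 0 ≤ M := by positivity
  have heq2 : ∀ v ∈ S, (q * (2 * c * p * v.1 + β)) ^ 2 + p * q * (2 * c * q * v.2 + γ) ^ 2 = M := by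
    intro v hv
    rw [hM]; linear_combination 4 * c * p * q ^ 2 * heq v hv
  have hinj : Set.InjOn (fun v : ℤ × ℤ => (q * (2 * c * p * v.1 + β), 2 * c * q * v.2 + γ)) S := by
    intro v _ w _ hvw
    simp only [Prod.mk.injEq] at hvw
    obtain ⟨h1, h2⟩ := hvw
    have h1 := mul_left_cancel₀ hq.ne' h1
    refine Prod.ext ?_ ?_
    · exact mul_left_cancel₀ (by simp [hxy, hp.ne'] : 2 * c * p ≠ 0) (by linarith)
    · exact mul_left_cancel₀ (by simp [hxy, hq.ne'] : 2 * c * q ≠ 0) (by linarith)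
  have hMbound : (M : ℝ) ≤ 32 * B ^ 10 := by
    have hQb : ∀ v ∈ S, |(Q v : ℝ)| ≤ 2 * B ^ 3 := by
      intro v hv
      obtain ⟨h1, h2⟩ := hSB v hv
      rw [hQ]; push_cast
      rw [abs_of_nonneg (by positivity), ← sq_abs (v.1 : ℝ), ← sq_abs (v.2 : ℝ)]
      calc _ ≤ B * B ^ 2 + B * B ^ 2 := by gcongr
        _ = _ := by ring
    have aux : ∀ s t z w : ℝ, |s| ≤ 2 * B ^ 3 → |t| ≤ 2 * B ^ 3 → |z| ≤ B → |w| ≤ B →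
        |s * z - t * w| ≤ 4 * B ^ 4 := by
      intro s t z w hs ht hz hw
      refine (abs_sub _ _).trans ?_
      rw [abs_mul, abs_mul]
      calc _ ≤ 2 * B ^ 3 * B + 2 * B ^ 3 * B := by gcongr
        _ = _ := by ring
    have hβb : |(β : ℝ)| ≤ 4 * B ^ 4 := by
      rw [hβ]; push_cast
      exact aux _ _ _ _ (hQb y hy) (hQb x hx) (hSB x hx).2 (hSB y hy).2
    have hγb : |(γ : ℝ)| ≤ 4 * B ^ 4 := by
      rw [hγ]; push_cast
      exact aux _ _ _ _ (hQb x hx) (hQb y hy) (hSB y hy).1 (hSB x hx).1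
    rw [hM]; push_cast
    rw [← sq_abs (β : ℝ), ← sq_abs (γ : ℝ)]
    calc _ ≤ B * (B * (4 * B ^ 4) ^ 2 + B * (4 * B ^ 4) ^ 2) := by gcongr
      _ = _ := by ring
  -- If M = 0 the ellipse is a single point, and the value 1 serves as a dummy M.
  rcases hM0.eq_or_lt with h0 | h0
  · refine ⟨1, one_ne_zero, by push_cast; nlinarith [one_le_pow₀ hB (n := 10)], ?_⟩
    have : S.card ≤ 1 := by
      rw [Finset.card_le_one]
      have hz : ∀ v ∈ S, q * (2 * c * p * v.1 + β) = 0 ∧ 2 * c * q * v.2 + γ = 0 := by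
        intro v hv
        have h1 := heq2 v hv
        rw [← h0] at h1
        have hpq : 0 < p * q := mul_pos hp hq
        have h2 : 0 ≤ p * q * (2 * c * q * v.2 + γ) ^ 2 := by positivity
        have h3 : p * q * (2 * c * q * v.2 + γ) ^ 2 = 0 := by
          nlinarith [sq_nonneg (q * (2 * c * p * v.1 + β))]
        constructor
        · rw [h3, add_zero] at h1; exact pow_eq_zero_iff two_ne_zero |>.mp h1
        · exact pow_eq_zero_iff two_ne_zero |>.mp ((mul_eq_zero.mp h3).resolve_left hpq.ne')
      intro v hv w hw
      exact hinj hv hw (Prod.ext ((hz v hv).1.trans (hz w hw).1.symm)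
        ((hz v hv).2.trans (hz w hw).2.symm))
    simpa using this.trans (by norm_num)
  · refine ⟨M.natAbs, by simpa using h0.ne', ?_, ?_⟩
    · rw [Nat.cast_natAbs, abs_of_pos h0]; exact hMbound
    · rw [← Finset.card_image_of_injOn hinj]
      apply card_ellipse_le (mul_pos hp hq) h0
      intro v hv
      obtain ⟨w, hw, rfl⟩ := Finset.mem_image.mp hv
      exact heq2 w hw

end

/-- Counting lattice points near a circle through the origin. -/
theorem exists_card_nearCircle_le (ε : ℝ) (hε : 0 < ε) :
    ∃ C : ℝ, 1 ≤ C ∧ ∀ A a b e : ℝ, 1 ≤ A → 0 ≤ e → e * A ^ 12 ≤ 1 / 60000 →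
      ∀ S : Finset (ℤ × ℤ), (∀ v ∈ S, NearCircle A a b e v) → (S.card : ℝ) ≤ C * A ^ ε := by
  -- M is at most 32(500A^7)^10 = O(A^70) and d(M) enters squared, hence 140.
  obtain ⟨C, hC1, hC⟩ := exists_card_divisors_le_rpow (ε / 140) (by positivity)
  set K : ℝ := 32 * 500 ^ 10 with hK
  have hK0 : 0 < K := by positivity
  refine ⟨10 * C ^ 2 * K ^ (ε / 70) + 2, by
    have : 0 ≤ 10 * C ^ 2 * K ^ (ε / 70) := by positivity
    linarith, fun A a b e hA he heA S hS => ?_⟩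
  have hA0 : 0 < A := by linarith
  have hAε : 1 ≤ A ^ ε := Real.one_le_rpow hA hε.le
  by_cases h : ∃ x ∈ S, ∃ y ∈ S, intCross x y ≠ 0
  · obtain ⟨x, hx, y, hy, hxy⟩ := h
    obtain ⟨p, q, hp, hq, hpA, hqA, hrel⟩ := exists_relation hA he heA S hS
    have hB : 1 ≤ 500 * A ^ 7 := by nlinarith [one_le_pow₀ hA (n := 7)]
    obtain ⟨M, hM0, hMle, hcard⟩ := card_le_of_relation hB hp hq hpA hqA S (by
      intro v hv
      have h1 : A ≤ A ^ 7 := le_self_pow₀ hA (by norm_num)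
      have h2 : A ^ 2 ≤ A ^ 7 := pow_le_pow_right₀ hA (by norm_num)
      exact ⟨(hS v hv).fst_le.trans (by linarith), (hS v hv).snd_le.trans (by linarith)⟩)
      hx hy hxy (fun v hv => hrel x hx y hy v hv)
    have hMK : (M : ℝ) ≤ K * A ^ (70 : ℕ) := hMle.trans_eq (by rw [hK]; ring)
    have hd := hC M hM0
    calc (S.card : ℝ) ≤ 10 * (M.divisors.card : ℝ) ^ 2 := by exact_mod_cast hcard
      _ ≤ 10 * (C * (M : ℝ) ^ (ε / 140)) ^ 2 := by gcongr
      _ = 10 * C ^ 2 * (M : ℝ) ^ (ε / 70) := by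
        rw [mul_pow, ← Real.rpow_natCast ((M : ℝ) ^ (ε / 140)) 2, ← Real.rpow_mul (by positivity)]
        rw [mul_assoc]; congr 3; push_cast; ring
      _ ≤ 10 * C ^ 2 * (K * A ^ (70 : ℕ)) ^ (ε / 70) := by gcongr
      _ = 10 * C ^ 2 * K ^ (ε / 70) * A ^ ε := by
        rw [Real.mul_rpow hK0.le (by positivity), ← Real.rpow_natCast A 70,
          ← Real.rpow_mul hA0.le, show ((70 : ℕ) : ℝ) * (ε / 70) = ε by push_cast; ring]
        ring
      _ ≤ _ := by gcongr; linarith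
  · push Not at h
    have h1 : (S.erase 0).card ≤ 1 := by
      rw [Finset.card_le_one]
      intro v hv w hw
      rw [Finset.mem_erase] at hv hw
      exact eq_of_intCross_eq_zero hA he heA (hS v hv.2) (hS w hw.2) hv.1 hw.1
        (h v hv.2 w hw.2)
    have h2 : S.card ≤ 2 := by
      have := Finset.pred_card_le_card_erase (s := S) (a := 0)
      omega
    calc (S.card : ℝ) ≤ 2 := by exact_mod_cast h2
      _ ≤ 2 * A ^ ε := by linarith
      _ ≤ _ := by
        gcongr
        have : 0 ≤ 10 * C ^ 2 * K ^ (ε / 70) := by positivity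
        linarith

/-! ### Poisson summation, T T* and Schur's test. -/

theorem summable_gaussian_int {c : ℝ} (hc : 0 < c) :
    Summable fun n : ℤ => Real.exp (-Real.pi * c * (n : ℝ) ^ 2) := by
  have := (summable_jacobiTheta₂_term_iff 0 (Complex.I * c)).mpr (by simpa using hc)
  refine this.norm.congr fun n => ?_
  rw [norm_jacobiTheta₂_term]
  simp only [Complex.mul_im, Complex.I_re, Complex.I_im, Complex.ofReal_re, Complex.ofReal_im]
  ring_nf
  simp

/-- Poisson summation for a modulated Gaussian, as a bound. -/
theorem enorm_tsum_gaussian_le {N : ℝ} (hN : 0 < N) (θ : ℝ) :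
    ‖∑' n : ℤ, (Real.exp (-Real.pi * (N⁻¹) ^ 2 * (n : ℝ) ^ 2) : ℂ) *
        Complex.exp (2 * Real.pi * Complex.I * ((n * θ : ℝ) : ℂ))‖ₑ ≤
      ENNReal.ofReal N * ∑' n : ℤ, ENNReal.ofReal (Real.exp (-Real.pi * N ^ 2 * (n - θ) ^ 2)) := by
  have ha : 0 < (((N⁻¹) ^ 2 : ℝ) : ℂ).re := by rw [Complex.ofReal_re]; positivity
  have h := Complex.tsum_exp_neg_quadratic ha (Complex.I * θ)
  have e1 : ∀ n : ℤ, (Real.exp (-Real.pi * (N⁻¹) ^ 2 * (n : ℝ) ^ 2) : ℂ) *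
        Complex.exp (2 * Real.pi * Complex.I * ((n * θ : ℝ) : ℂ)) =
      Complex.exp (-Real.pi * (((N⁻¹) ^ 2 : ℝ) : ℂ) * n ^ 2 +
        2 * Real.pi * (Complex.I * θ) * n) := by
    intro n
    rw [Complex.exp_add]; push_cast; congr 2; ring
  simp_rw [e1]
  rw [h, enorm_mul]
  gcongr
  · have : (((N⁻¹) ^ 2 : ℝ) : ℂ) ^ (1 / 2 : ℂ) = ((N⁻¹ : ℝ) : ℂ) := by
      rw [show (1 / 2 : ℂ) = ((1 / 2 : ℝ) : ℂ) by push_cast; rfl, ← Complex.ofReal_cpow (by positivity),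
        ← Real.sqrt_eq_rpow, Real.sqrt_sq (by positivity)]
    rw [this, ← ofReal_norm]
    apply ENNReal.ofReal_le_ofReal
    simp [abs_of_pos hN]
  · refine enorm_tsum_le_tsum_enorm.trans (ENNReal.tsum_le_tsum fun n => ?_)
    rw [← ofReal_norm, Complex.norm_exp]
    apply ENNReal.ofReal_le_ofReal
    apply Real.exp_le_exp.mpr
    apply le_of_eq
    have : -(Real.pi : ℂ) / (((N⁻¹) ^ 2 : ℝ) : ℂ) * (n + Complex.I * (Complex.I * θ)) ^ 2 =
        ((-Real.pi * N ^ 2 * (n - θ) ^ 2 : ℝ) : ℂ) := by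
      have : (n + Complex.I * (Complex.I * θ)) = (n - θ : ℂ) := by
        rw [← mul_assoc, Complex.I_mul_I]; ring
      rw [this]; push_cast; field_simp
    rw [this, Complex.ofReal_re]

/-- The `T T*` step: a weighted sum of squared Fourier-type coefficients is bounded by the quadratic
form of its kernel. -/
theorem tsum_mul_enorm_integral_sq_le {α ι : Type*} [MeasurableSpace α] [Countable ι]
    (μ : Measure α) [SFinite μ] (w : ι → ℝ) (hw : ∀ i, 0 ≤ w i) (hws : Summable w)
    (φ : ι → α → ℝ) (hφ : ∀ i, Measurable (φ i)) (g : α → ℂ) (hg : Integrable g μ) :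
    ∑' i, ENNReal.ofReal (w i) *
        ‖∫ t, g t * Complex.exp (2 * Real.pi * Complex.I * (φ i t : ℂ)) ∂μ‖ₑ ^ 2 ≤
      ∫⁻ z, ‖g z.1‖ₑ * ‖g z.2‖ₑ * ‖∑' i, (w i : ℂ) *
        Complex.exp (2 * Real.pi * Complex.I * ((φ i z.1 - φ i z.2 : ℝ) : ℂ))‖ₑ ∂(μ.prod μ) := by
  set e : ι → α → ℂ := fun i t => Complex.exp (2 * Real.pi * Complex.I * (φ i t : ℂ)) with he
  have hen : ∀ i t, ‖e i t‖ = 1 := by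
    intro i t
    rw [he]; simp only
    rw [show 2 * Real.pi * Complex.I * (φ i t : ℂ) = ((2 * Real.pi * φ i t : ℝ) : ℂ) * Complex.I by
      push_cast; ring]
    exact Complex.norm_exp_ofReal_mul_I _
  have hem : ∀ i, Measurable (e i) := by
    intro i
    have := hφ i
    fun_prop
  have hgi : ∀ i, Integrable (fun t => g t * e i t) μ := fun i =>
    hg.mul_bdd (hem i).aestronglyMeasurable (Filter.Eventually.of_forall fun t => (hen i t).le)
  have hgc : ∀ i, Integrable (fun t => (starRingEnd ℂ) (g t * e i t)) μ := fun i =>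
    (RCLike.conjLIE (K := ℂ)).toContinuousLinearEquiv.toContinuousLinearMap.integrable_comp (hgi i)
  set F : ι → α × α → ℂ := fun i z =>
    (w i : ℂ) * ((g z.1 * e i z.1) * (starRingEnd ℂ) (g z.2 * e i z.2)) with hF
  have hFi : ∀ i, Integrable (F i) (μ.prod μ) := fun i =>
    ((hgi i).mul_prod (hgc i)).const_mul _
  have hFn : ∀ i, ∫ z, ‖F i z‖ ∂(μ.prod μ) = w i * (∫ t, ‖g t‖ ∂μ) ^ 2 := by
    intro i
    have : ∀ z, ‖F i z‖ = w i * (‖g z.1‖ * ‖g z.2‖) := by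
      intro z
      simp only [hF, norm_mul, RCLike.norm_conj, hen, mul_one, Complex.norm_real,
        Real.norm_of_nonneg (hw i)]
    simp_rw [this]
    rw [integral_const_mul, integral_prod_mul (fun t => ‖g t‖) (fun t => ‖g t‖), sq]
  have hsum := integral_tsum_of_summable_integral_norm hFi
    (by simp_rw [hFn]; exact hws.mul_right _)
  have hint : ∀ i, ∫ z, F i z ∂(μ.prod μ) =
      ((w i * ‖∫ t, g t * e i t ∂μ‖ ^ 2 : ℝ) : ℂ) := by
    intro i
    simp only [hF]
    rw [integral_const_mul, integral_prod_mul (fun t => g t * e i t)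
      (fun t => (starRingEnd ℂ) (g t * e i t)), integral_conj, Complex.mul_conj,
      Complex.normSq_eq_norm_sq]
    push_cast; rfl
  have hsr : Summable fun i => w i * ‖∫ t, g t * e i t ∂μ‖ ^ 2 := by
    refine Summable.of_nonneg_of_le (fun i => mul_nonneg (hw i) (by positivity)) (fun i => ?_)
      (hws.mul_right ((∫ t, ‖g t‖ ∂μ) ^ 2))
    have := hw i
    gcongr
    refine (norm_integral_le_integral_norm _).trans (le_of_eq ?_)
    simp [hen]
  have h1 : ∑' i, ENNReal.ofReal (w i) * ‖∫ t, g t * e i t ∂μ‖ₑ ^ 2 =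
      ‖∑' i, ∫ z, F i z ∂(μ.prod μ)‖ₑ := by
    simp_rw [hint]
    rw [← Complex.ofReal_tsum, ← ofReal_norm, Complex.norm_real, Real.norm_of_nonneg
      (tsum_nonneg fun i => mul_nonneg (hw i) (by positivity)),
      ENNReal.ofReal_tsum_of_nonneg (fun i => mul_nonneg (hw i) (by positivity)) hsr]
    congr 1; ext i
    rw [ENNReal.ofReal_mul (hw i), ENNReal.ofReal_pow (norm_nonneg _), ofReal_norm]
  rw [h1, hsum]
  refine (enorm_integral_le_lintegral_enorm _).trans (lintegral_mono fun z => le_of_eq ?_)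
  have h2 : ∀ i, F i z = (g z.1 * (starRingEnd ℂ) (g z.2)) * ((w i : ℂ) *
        Complex.exp (2 * Real.pi * Complex.I * ((φ i z.1 - φ i z.2 : ℝ) : ℂ))) := by
    intro i
    have h3 : (starRingEnd ℂ) (e i z.2) =
        Complex.exp (-(2 * Real.pi * Complex.I * (φ i z.2 : ℂ))) := by
      rw [he]; simp only
      rw [← Complex.exp_conj]; congr 1
      simp [Complex.conj_ofNat]
    have h4 : Complex.exp (2 * Real.pi * Complex.I * ((φ i z.1 - φ i z.2 : ℝ) : ℂ)) =
        e i z.1 * Complex.exp (-(2 * Real.pi * Complex.I * (φ i z.2 : ℂ))) := by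
      rw [he]; simp only
      rw [← Complex.exp_add]; congr 1; push_cast; ring
    simp only [hF]
    rw [map_mul, h3, h4]; ring
  simp_rw [h2]
  rw [tsum_mul_left, enorm_mul, enorm_mul, RCLike.enorm_conj]

/-- Schur's test. -/
theorem lintegral_schur_le {α : Type*} [MeasurableSpace α] (μ : Measure α) [SFinite μ]
    (K : α → α → ENNReal) (hK : Measurable (Function.uncurry K)) (B : ENNReal)
    (h1 : ∀ᵐ s ∂μ, ∫⁻ t, K s t ∂μ ≤ B) (h2 : ∀ᵐ t ∂μ, ∫⁻ s, K s t ∂μ ≤ B)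
    (g : α → ENNReal) (hg : AEMeasurable g μ) :
    ∫⁻ z, g z.1 * g z.2 * K z.1 z.2 ∂(μ.prod μ) ≤ 2 * B * ∫⁻ t, g t ^ 2 ∂μ := by
  have hg1 : AEMeasurable (fun z : α × α => g z.1) (μ.prod μ) := hg.comp_fst
  have hg2 : AEMeasurable (fun z : α × α => g z.2) (μ.prod μ) := hg.comp_snd
  have hKm : Measurable (fun z : α × α => K z.1 z.2) := hK
  -- The missing factor 1/2 only accounts for the 2 in the conclusion.
  have le1 : ∀ x y : ENNReal, x * y ≤ x ^ 2 + y ^ 2 := by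
    intro x y
    rcases le_total x y with h | h
    · exact (mul_le_mul_left h y).trans (by rw [← sq]; exact le_add_self)
    · exact (mul_le_mul_right h x).trans (by rw [← sq]; exact le_self_add)
  calc _ ≤ ∫⁻ z, g z.1 ^ 2 * K z.1 z.2 + g z.2 ^ 2 * K z.1 z.2 ∂(μ.prod μ) := by
        refine lintegral_mono fun z => ?_
        rw [← add_mul]
        gcongr
        exact le1 _ _
    _ = ∫⁻ z, g z.1 ^ 2 * K z.1 z.2 ∂(μ.prod μ) + ∫⁻ z, g z.2 ^ 2 * K z.1 z.2 ∂(μ.prod μ) :=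
        lintegral_add_left' ((hg1.pow_const 2).mul hKm.aemeasurable) _
    _ ≤ B * ∫⁻ t, g t ^ 2 ∂μ + B * ∫⁻ t, g t ^ 2 ∂μ := by
        gcongr
        · rw [lintegral_prod (fun z : α × α => g z.1 ^ 2 * K z.1 z.2)
              ((hg1.pow_const 2).mul hKm.aemeasurable),
            ← lintegral_const_mul'' _ (hg.pow_const 2)]
          refine lintegral_mono_ae ?_
          filter_upwards [h1] with s hs
          rw [lintegral_const_mul _ (by fun_prop), mul_comm]
          gcongr
        · rw [lintegral_prod_symm (fun z : α × α => g z.2 ^ 2 * K z.1 z.2)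
              ((hg2.pow_const 2).mul hKm.aemeasurable),
            ← lintegral_const_mul'' _ (hg.pow_const 2)]
          refine lintegral_mono_ae ?_
          filter_upwards [h2] with s hs
          rw [lintegral_const_mul _ (by fun_prop), mul_comm]
          gcongr
    _ = _ := by ring

/-! ### Arc length and Gaussians on the circle. -/

theorem hasDerivAt_plane {f g : ℝ → ℝ} {f' g' t : ℝ} (hf : HasDerivAt f f' t)
    (hg : HasDerivAt g g' t) : HasDerivAt (fun t => (!₂[f t, g t] : Plane)) !₂[f', g'] t := by
  have h : HasDerivAt (fun t => (![f t, g t] : Fin 2 → ℝ)) ![f', g'] t := by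
    rw [hasDerivAt_pi]
    intro i
    fin_cases i <;> simpa
  exact ((PiLp.continuousLinearEquiv 2 ℝ (fun _ : Fin 2 => ℝ)).symm.hasFDerivAt.comp_hasDerivAt
    t h)

/-- The parametrization of the unit circle by the angle. -/
noncomputable def circlePoint (t : ℝ) : Plane := !₂[Real.cos t, Real.sin t]

theorem continuous_circlePoint : Continuous circlePoint :=
  continuous_iff_continuousAt.mpr fun t =>
    (hasDerivAt_plane (Real.hasDerivAt_cos t) (Real.hasDerivAt_sin t)).continuousAt

theorem circleMeasure_eq_map :
    circleMeasure = (volume.restrict (Set.Icc 0 (2 * Real.pi))).map circlePoint := by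
  have h : ∀ t, ‖deriv (fun t => (!₂[Real.cos t, Real.sin t] : Plane)) t‖ₑ = 1 := by
    intro t
    rw [(hasDerivAt_plane (Real.hasDerivAt_cos t) (Real.hasDerivAt_sin t)).deriv,
      ← ofReal_norm, EuclideanSpace.norm_eq]
    simp
  rw [circleMeasure, arcLength]
  simp_rw [h]
  rw [withDensity_const, one_smul]
  rfl

instance : IsFiniteMeasure circleMeasure := by
  rw [circleMeasure_eq_map]; infer_instance

theorem ae_circleMeasure : ∀ᵐ ξ ∂circleMeasure, ξ 0 ^ 2 + ξ 1 ^ 2 = 1 := by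
  rw [circleMeasure_eq_map, ae_map_iff continuous_circlePoint.aemeasurable
    (measurableSet_eq_fun (by fun_prop) (by fun_prop))]
  exact Filter.Eventually.of_forall fun t => by simp [circlePoint]

/-- Periodicity moves the integral to [-π, π], where 1 - cos u ≥ 2u²/π² compares it with a full
Gaussian integral. -/
theorem integral_exp_one_sub_cos_le {c : ℝ} (hc : 0 < c) (s : ℝ) :
    ∫ t in (0 : ℝ)..(2 * Real.pi), Real.exp (-c * (1 - Real.cos (t - s))) ≤
      Real.sqrt (Real.pi / (c * (2 / Real.pi ^ 2))) := by
  have hp := Real.pi_pos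
  set f : ℝ → ℝ := fun u => Real.exp (-c * (1 - Real.cos u)) with hf
  have hper : Function.Periodic f (2 * Real.pi) := fun u => by simp [hf]
  have hb : 0 < c * (2 / Real.pi ^ 2) := by positivity
  calc ∫ t in (0 : ℝ)..(2 * Real.pi), f (t - s) = ∫ u in (0 - s)..(2 * Real.pi - s), f u :=
        intervalIntegral.integral_comp_sub_right f s
    _ = ∫ u in (0 - s)..(0 - s + 2 * Real.pi), f u := by congr 1; ring
    _ = ∫ u in (-Real.pi)..(-Real.pi + 2 * Real.pi), f u := hper.intervalIntegral_add_eq _ _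
    _ ≤ ∫ u in (-Real.pi)..(-Real.pi + 2 * Real.pi), Real.exp (-(c * (2 / Real.pi ^ 2)) * u ^ 2) := by
        apply intervalIntegral.integral_mono_on (by linarith)
        · exact Continuous.intervalIntegrable (by fun_prop) _ _
        · exact Continuous.intervalIntegrable (by fun_prop) _ _
        · intro u hu
          apply Real.exp_le_exp.mpr
          have : |u| ≤ Real.pi := abs_le.mpr ⟨hu.1, by linarith [hu.2]⟩
          have h2 := Real.cos_le_one_sub_mul_cos_sq this
          nlinarith
    _ ≤ ∫ u : ℝ, Real.exp (-(c * (2 / Real.pi ^ 2)) * u ^ 2) := by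
        rw [intervalIntegral.integral_of_le (by linarith)]
        exact setIntegral_le_integral (integrable_exp_neg_mul_sq hb)
          (Filter.Eventually.of_forall fun u => (Real.exp_pos _).le)
    _ = _ := integral_gaussian _

/-- A Gaussian of width `1 / R` centred at `y`, integrated over the unit circle. -/
theorem lintegral_gaussian_circle_le {R : ℝ} (hR : 0 < R) (x y : ℝ) :
    ∫⁻ ξ, ENNReal.ofReal (Real.exp (-Real.pi * R ^ 2 * ((x - ξ 0) ^ 2 + (y - ξ 1) ^ 2)))
        ∂circleMeasure ≤
      ENNReal.ofReal (4 * Real.pi / R *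
        Real.exp (-(Real.pi / 2) * R ^ 2 * (Real.sqrt (x ^ 2 + y ^ 2) - 1) ^ 2)) := by
  have hp := Real.pi_pos
  set ρ := Real.sqrt (x ^ 2 + y ^ 2) with hρ
  have hρ0 : 0 ≤ ρ := Real.sqrt_nonneg _
  obtain ⟨s, hs1, hs2⟩ : ∃ s, x = ρ * Real.cos s ∧ y = ρ * Real.sin s := by
    have hn : ‖(⟨x, y⟩ : ℂ)‖ = ρ := by
      rw [hρ, Complex.norm_def, Complex.normSq_mk]; congr 1; ring
    exact ⟨Complex.arg ⟨x, y⟩, by rw [← hn, Complex.norm_mul_cos_arg],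
      by rw [← hn, Complex.norm_mul_sin_arg]⟩
  rw [circleMeasure_eq_map, lintegral_map (by fun_prop) continuous_circlePoint.measurable]
  have hpt : ∀ t, Real.exp (-Real.pi * R ^ 2 * ((x - circlePoint t 0) ^ 2 +
      (y - circlePoint t 1) ^ 2)) ≤
      Real.exp (-(Real.pi / 2) * R ^ 2 * (ρ - 1) ^ 2) *
        Real.exp (-(Real.pi * R ^ 2 / 16) * (1 - Real.cos (t - s))) := by
    intro t
    rw [← Real.exp_add]
    apply Real.exp_le_exp.mpr
    have hid : (x - circlePoint t 0) ^ 2 + (y - circlePoint t 1) ^ 2 =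
        (ρ - 1) ^ 2 + 2 * ρ * (1 - Real.cos (t - s)) := by
      simp only [circlePoint, Matrix.cons_val_zero, Matrix.cons_val_one, PiLp.toLp_apply]
      rw [hs1, hs2, Real.cos_sub]
      linear_combination ρ ^ 2 * Real.sin_sq_add_cos_sq s + Real.sin_sq_add_cos_sq t
    have hc := Real.cos_le_one (t - s)
    have hc' := Real.neg_one_le_cos (t - s)
    -- Angular decay must be uniform in ρ. For ρ ≥ 1/2 it comes from 2ρ ≥ 1; for ρ ≤ 1/2 half of (ρ
    -- - 1)² is at least 1/8, which covers (1 - cos)/16.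
    have hkey : (ρ - 1) ^ 2 / 2 + (1 - Real.cos (t - s)) / 16 ≤
        (ρ - 1) ^ 2 + 2 * ρ * (1 - Real.cos (t - s)) := by
      generalize Real.cos (t - s) = k at *
      rcases le_total ρ (1 / 2) with h | h
      · nlinarith [mul_nonneg hρ0 (sub_nonneg.mpr hc), sq_nonneg (ρ - 1 / 2)]
      · nlinarith [mul_nonneg (sub_nonneg.mpr h) (sub_nonneg.mpr hc), sq_nonneg (ρ - 1)]
    rw [hid]
    have := mul_le_mul_of_nonneg_left hkey (by positivity : 0 ≤ Real.pi * R ^ 2)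
    nlinarith
  calc _ ≤ ∫⁻ t in Set.Icc 0 (2 * Real.pi),
        ENNReal.ofReal (Real.exp (-(Real.pi / 2) * R ^ 2 * (ρ - 1) ^ 2) *
        Real.exp (-(Real.pi * R ^ 2 / 16) * (1 - Real.cos (t - s)))) :=
        lintegral_mono fun t => ENNReal.ofReal_le_ofReal (hpt t)
    _ = ENNReal.ofReal (∫ t in Set.Icc 0 (2 * Real.pi),
        (Real.exp (-(Real.pi / 2) * R ^ 2 * (ρ - 1) ^ 2) *
        Real.exp (-(Real.pi * R ^ 2 / 16) * (1 - Real.cos (t - s))))) := by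
        rw [ofReal_integral_eq_lintegral_ofReal]
        · exact ContinuousOn.integrableOn_Icc (by fun_prop)
        · exact Filter.Eventually.of_forall fun t => by positivity
    _ ≤ _ := by
        apply ENNReal.ofReal_le_ofReal
        rw [integral_const_mul, mul_comm (4 * Real.pi / R), integral_Icc_eq_integral_Ioc,
          ← intervalIntegral.integral_of_le (by positivity)]
        gcongr
        refine (integral_exp_one_sub_cos_le (by positivity) s).trans ?_
        apply Real.sqrt_le_iff.mpr
        refine ⟨by positivity, ?_⟩
        have : Real.pi / (Real.pi * R ^ 2 / 16 * (2 / Real.pi ^ 2)) = 8 * Real.pi ^ 2 / R ^ 2 := by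
          field_simp; norm_num
        rw [this, div_pow]
        gcongr
        nlinarith

/-! ### Counting dual lattice translates with Gaussian weights. -/

theorem tsum_inv_one_add_sq_ne_top :
    ∑' m : ℤ, ENNReal.ofReal (1 / (1 + (m : ℝ) ^ 2)) ≠ ⊤ := by
  have h : Summable fun m : ℤ => 1 / (1 + (m : ℝ) ^ 2) := by
    have h2 : Summable fun m : ℤ => 1 / (m : ℝ) ^ 2 := by
      simpa using (Real.summable_one_div_int_pow (p := 2)).mpr one_lt_two
    refine Summable.of_norm_bounded_eventually h2 ?_
    filter_upwards [(Set.finite_singleton (0 : ℤ)).compl_mem_cofinite] with m hm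
    have hm0 : (m : ℝ) ≠ 0 := by simpa using hm
    have : 0 < (m : ℝ) ^ 2 := by positivity
    rw [Real.norm_of_nonneg (by positivity)]
    gcongr
    linarith
  exact h.tsum_ofReal_ne_top

/-- The Gaussian profile is negligible away from the circle. -/
theorem exp_far_le {A R d m n ρ : ℝ} (hA : 1 ≤ A) (hAR : A ^ 28 ≤ R) (hd : (A ^ 24)⁻¹ ≤ |d|)
    (hρ : ρ ≤ |d| + 2) (hρ0 : 0 ≤ ρ) (hm : |m| ≤ A * ρ) (hn : |n| ≤ A ^ 2 * ρ) :
    Real.exp (-(Real.pi / 2) * R ^ 2 * d ^ 2) ≤ 2187 * (1 / (1 + m ^ 2) * (1 / (1 + n ^ 2))) := by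
  have hR : 1 ≤ R := (one_le_pow₀ hA).trans hAR
  set x := R ^ 2 * d ^ 2 with hx
  have hx0 : 0 ≤ x := by positivity
  -- (A^28 · A^-24)² = A^8. This absorbs the loss A² · A⁴ from rescaling m and n, so the far tail is
  -- bounded uniformly in A.
  have hxA : A ^ 8 ≤ x := by
    have h1 : (A ^ 28) ^ 2 * ((A ^ 24)⁻¹) ^ 2 ≤ R ^ 2 * |d| ^ 2 := by gcongr
    rw [sq_abs] at h1
    calc A ^ 8 = (A ^ 28) ^ 2 * ((A ^ 24)⁻¹) ^ 2 := by field_simp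
      _ ≤ x := h1
  have hA6 : A ^ 6 ≤ x := (pow_le_pow_right₀ hA (by norm_num)).trans hxA
  have hdx : d ^ 2 ≤ x := by
    rw [hx]; exact le_mul_of_one_le_left (sq_nonneg d) (one_le_pow₀ hR)
  have hρ2 : ρ ^ 2 ≤ 2 * x + 8 := by
    calc ρ ^ 2 ≤ (|d| + 2) ^ 2 := by gcongr
      _ ≤ 2 * |d| ^ 2 + 8 := by nlinarith [sq_nonneg (|d| - 2)]
      _ ≤ _ := by rw [sq_abs]; linarith
  have hm2 : 1 + m ^ 2 ≤ A ^ 2 * (9 * (1 + x)) := by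
    have h1 : m ^ 2 ≤ A ^ 2 * (2 * x + 8) := by
      calc m ^ 2 = |m| ^ 2 := (sq_abs m).symm
        _ ≤ (A * ρ) ^ 2 := by gcongr
        _ = A ^ 2 * ρ ^ 2 := by ring
        _ ≤ _ := by gcongr
    have h2 : 1 ≤ A ^ 2 := one_le_pow₀ hA
    nlinarith
  have hn2 : 1 + n ^ 2 ≤ A ^ 4 * (9 * (1 + x)) := by
    have h1 : n ^ 2 ≤ A ^ 4 * (2 * x + 8) := by
      calc n ^ 2 = |n| ^ 2 := (sq_abs n).symm
        _ ≤ (A ^ 2 * ρ) ^ 2 := by gcongr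
        _ = A ^ 4 * ρ ^ 2 := by ring
        _ ≤ _ := by gcongr
    have h2 : 1 ≤ A ^ 4 := one_le_pow₀ hA
    nlinarith
  have hexp : (1 + x) ^ 3 ≤ 27 * Real.exp x := by
    have h1 : 1 + x / 3 ≤ Real.exp (x / 3) := by linarith [Real.add_one_le_exp (x / 3)]
    calc (1 + x) ^ 3 ≤ (3 * (1 + x / 3)) ^ 3 := by gcongr; linarith
      _ ≤ (3 * Real.exp (x / 3)) ^ 3 := by gcongr
      _ = 27 * Real.exp (x / 3) ^ 3 := by ring
      _ = 27 * Real.exp x := by rw [← Real.exp_nat_mul]; congr 2; push_cast; ring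
  have hprod : (1 + m ^ 2) * (1 + n ^ 2) ≤ 2187 * Real.exp x := by
    calc (1 + m ^ 2) * (1 + n ^ 2) ≤ (A ^ 2 * (9 * (1 + x))) * (A ^ 4 * (9 * (1 + x))) := by gcongr
      _ = A ^ 6 * (81 * (1 + x) ^ 2) := by ring
      _ ≤ (1 + x) * (81 * (1 + x) ^ 2) := by gcongr; linarith
      _ = 81 * (1 + x) ^ 3 := by ring
      _ ≤ 81 * (27 * Real.exp x) := by gcongr
      _ = _ := by ring
  calc Real.exp (-(Real.pi / 2) * R ^ 2 * d ^ 2) ≤ Real.exp (-x) := by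
        apply Real.exp_le_exp.mpr
        have h1 : 1 * x ≤ Real.pi / 2 * x := by gcongr; linarith [Real.pi_gt_three]
        have h2 : -(Real.pi / 2) * R ^ 2 * d ^ 2 = -(Real.pi / 2 * x) := by rw [hx]; ring
        rw [h2]; linarith
    _ ≤ _ := by
        rw [Real.exp_neg, inv_eq_one_div, one_div_mul_one_div, mul_one_div,
          div_le_div_iff₀ (Real.exp_pos x) (by positivity)]
        linarith

/-- For |ξ| = 1 and P = (m/A, n/A²), one has (ρ - 1)(ρ + 1) = |P|² - 2ξ·P; times A⁴ this is the form
in `NearCircle`. The 3 bounds ρ + 1. -/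
theorem nearCircle_of_abs_sub_le {A ξ₀ ξ₁ ρ : ℝ} (hA : 1 ≤ A) (hξ : ξ₀ ^ 2 + ξ₁ ^ 2 = 1)
    {p : ℤ × ℤ} (hρ : ρ ^ 2 = (ξ₀ - p.1 / A) ^ 2 + (ξ₁ - p.2 / A ^ 2) ^ 2)
    (h0 : 0 ≤ ρ) (hm : |(p.1 : ℝ)| ≤ A * (ρ + 1)) (hn : |(p.2 : ℝ)| ≤ A ^ 2 * (ρ + 1))
    (h : |ρ - 1| ≤ (A ^ 24)⁻¹) : NearCircle A ξ₀ ξ₁ (3 * (A ^ 24)⁻¹) p := by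
  have hA0 : 0 < A := by linarith
  have hi : (A ^ 24)⁻¹ ≤ 1 := inv_le_one_of_one_le₀ (one_le_pow₀ hA)
  have hρ2 : ρ ≤ 2 := by linarith [(abs_le.mp h).2]
  refine ⟨?_, ?_, ?_⟩
  · nlinarith
  · nlinarith [sq_nonneg A]
  · have hid : A ^ 2 * (p.1 : ℝ) ^ 2 + (p.2 : ℝ) ^ 2 - 2 * ξ₀ * A ^ 3 * p.1 - 2 * ξ₁ * A ^ 2 * p.2 =
        (ρ - 1) * (ρ + 1) * A ^ 4 := by
      have : (ρ - 1) * (ρ + 1) = (p.1 / A) ^ 2 - 2 * ξ₀ * (p.1 / A) +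
          ((p.2 / A ^ 2) ^ 2 - 2 * ξ₁ * (p.2 / A ^ 2)) := by
        linear_combination hρ + hξ
      rw [this]; field_simp; ring
    rw [hid, abs_mul, abs_mul, abs_of_nonneg (by positivity : 0 ≤ A ^ 4),
      abs_of_nonneg (by linarith : 0 ≤ ρ + 1)]
    rw [mul_comm 3]
    gcongr
    linarith

/-- For small A the thickness 3A⁻²⁴ need not be thin enough for the arithmetic count, so a box is
counted instead: 19 · 55 = 1045. From A = 3 on, 3/A^12 ≤ 1/60000 holds. -/
theorem card_nearCircle_le_of_lt {A a b e : ℝ} (hA : 1 ≤ A) (hA3 : A < 3) (S : Finset (ℤ × ℤ))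
    (hS : ∀ v ∈ S, NearCircle A a b e v) : S.card ≤ 1045 := by
  have hsub : S ⊆ Finset.Icc (-9 : ℤ) 9 ×ˢ Finset.Icc (-27 : ℤ) 27 := by
    intro v hv
    have h1 := abs_le.mp ((hS v hv).fst_le.trans (by linarith : 3 * A ≤ 9))
    have h2 := abs_le.mp ((hS v hv).snd_le.trans (by nlinarith : 3 * A ^ 2 ≤ 27))
    simp only [Finset.mem_product, Finset.mem_Icc]
    exact ⟨⟨by exact_mod_cast h1.1, by exact_mod_cast h1.2⟩,
      ⟨by exact_mod_cast h2.1, by exact_mod_cast h2.2⟩⟩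
  exact (Finset.card_le_card hsub).trans (by simp)

/-- The number of translates of the circle by the dual lattice that come near a point, with
Gaussian weights. -/
theorem exists_tsum_exp_le (ε : ℝ) (hε : 0 < ε) : ∃ C : ℝ, 0 < C ∧ ∀ A R ξ₀ ξ₁ : ℝ,
    1 ≤ A → A ^ 28 ≤ R → ξ₀ ^ 2 + ξ₁ ^ 2 = 1 →
    ∑' p : ℤ × ℤ, ENNReal.ofReal (Real.exp (-(Real.pi / 2) * R ^ 2 *
      (Real.sqrt ((ξ₀ - p.1 / A) ^ 2 + (ξ₁ - p.2 / A ^ 2) ^ 2) - 1) ^ 2)) ≤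
      ENNReal.ofReal (C * A ^ ε) := by
  obtain ⟨C, hC1, hC⟩ := exists_card_nearCircle_le ε hε
  set Z := ∑' m : ℤ, ENNReal.ofReal (1 / (1 + (m : ℝ) ^ 2)) with hZ
  have hZt : Z ≠ ⊤ := tsum_inv_one_add_sq_ne_top
  refine ⟨C + 1045 + 2187 * Z.toReal ^ 2, by positivity, fun A R ξ₀ ξ₁ hA hAR hξ => ?_⟩
  have hA0 : 0 < A := by linarith
  have hAε : 1 ≤ A ^ ε := Real.one_le_rpow hA hε.le
  set ρ : ℤ × ℤ → ℝ := fun p => Real.sqrt ((ξ₀ - p.1 / A) ^ 2 + (ξ₁ - p.2 / A ^ 2) ^ 2) with hρdef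
  have hρ0 : ∀ p, 0 ≤ ρ p := fun p => Real.sqrt_nonneg _
  have hρ2 : ∀ p, ρ p ^ 2 = (ξ₀ - p.1 / A) ^ 2 + (ξ₁ - p.2 / A ^ 2) ^ 2 := fun p =>
    Real.sq_sqrt (by positivity)
  have hm : ∀ p : ℤ × ℤ, |(p.1 : ℝ)| ≤ A * (ρ p + 1) := by
    intro p
    have h1 : |ξ₀ - p.1 / A| ≤ ρ p := Real.abs_le_sqrt (by nlinarith [sq_nonneg (ξ₁ - p.2 / A ^ 2)])
    have h2 : |ξ₀| ≤ 1 := abs_le_one_iff_mul_self_le_one.mpr (by nlinarith)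
    have h3 : (p.1 : ℝ) = A * (ξ₀ - (ξ₀ - p.1 / A)) := by field_simp; ring
    rw [h3, abs_mul, abs_of_pos hA0]
    gcongr
    exact (abs_sub _ _).trans (by linarith)
  have hn : ∀ p : ℤ × ℤ, |(p.2 : ℝ)| ≤ A ^ 2 * (ρ p + 1) := by
    intro p
    have h1 : |ξ₁ - p.2 / A ^ 2| ≤ ρ p := Real.abs_le_sqrt (by nlinarith [sq_nonneg (ξ₀ - p.1 / A)])
    have h2 : |ξ₁| ≤ 1 := abs_le_one_iff_mul_self_le_one.mpr (by nlinarith)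
    have h3 : (p.2 : ℝ) = A ^ 2 * (ξ₁ - (ξ₁ - p.2 / A ^ 2)) := by field_simp; ring
    rw [h3, abs_mul, abs_of_pos (by positivity : 0 < A ^ 2)]
    gcongr
    exact (abs_sub _ _).trans (by linarith)
  have hnear : ∀ p, |ρ p - 1| ≤ (A ^ 24)⁻¹ → NearCircle A ξ₀ ξ₁ (3 * (A ^ 24)⁻¹) p := fun p hp =>
    nearCircle_of_abs_sub_le hA hξ (hρ2 p) (hρ0 p) (hm p) (hn p) hp
  set T : Set (ℤ × ℤ) := {p | |ρ p - 1| ≤ (A ^ 24)⁻¹} with hT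
  have hTfin : T.Finite := by
    refine Set.Finite.subset ((Finset.Icc (-⌈3 * A⌉) ⌈3 * A⌉ ×ˢ
      Finset.Icc (-⌈3 * A ^ 2⌉) ⌈3 * A ^ 2⌉).finite_toSet) fun p hp => ?_
    have h := hnear p hp
    have h1 := abs_le.mp (h.fst_le.trans (Int.le_ceil _))
    have h2 := abs_le.mp (h.snd_le.trans (Int.le_ceil _))
    simp only [Finset.coe_product, Set.mem_prod, Finset.coe_Icc, Set.mem_Icc]
    exact ⟨⟨by exact_mod_cast h1.1, by exact_mod_cast h1.2⟩,
      ⟨by exact_mod_cast h2.1, by exact_mod_cast h2.2⟩⟩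
  set S := hTfin.toFinset with hS
  have hScard : (S.card : ℝ) ≤ (C + 1045) * A ^ ε := by
    have hSn : ∀ v ∈ S, NearCircle A ξ₀ ξ₁ (3 * (A ^ 24)⁻¹) v := fun v hv =>
      hnear v (hTfin.mem_toFinset.mp hv)
    rcases lt_or_ge A 3 with h3 | h3
    · have : (S.card : ℝ) ≤ 1045 := by exact_mod_cast card_nearCircle_le_of_lt hA h3 S hSn
      nlinarith
    · have := hC A ξ₀ ξ₁ (3 * (A ^ 24)⁻¹) hA (by positivity) (by
        have h4 : (3 : ℝ) ^ 12 ≤ A ^ 12 := by gcongr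
        have h5 : 3 * (A ^ 24)⁻¹ * A ^ 12 = 3 / A ^ 12 := by field_simp
        rw [h5, div_le_div_iff₀ (by positivity) (by norm_num)]
        linarith) S hSn
      nlinarith
  -- Near points contribute at most 1 each; the others are dominated by a summable product that does
  -- not depend on A or R.
  have hterm : ∀ p : ℤ × ℤ, ENNReal.ofReal (Real.exp (-(Real.pi / 2) * R ^ 2 * (ρ p - 1) ^ 2)) ≤
      Set.indicator T 1 p + 2187 * (ENNReal.ofReal (1 / (1 + (p.1 : ℝ) ^ 2)) *
        ENNReal.ofReal (1 / (1 + (p.2 : ℝ) ^ 2))) := by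
    intro p
    by_cases hp : p ∈ T
    · rw [Set.indicator_of_mem hp, Pi.one_apply]
      refine le_trans ?_ le_self_add
      rw [← ENNReal.ofReal_one]
      apply ENNReal.ofReal_le_ofReal
      rw [Real.exp_le_one_iff]
      have : 0 ≤ Real.pi / 2 * R ^ 2 * (ρ p - 1) ^ 2 := by
        have := Real.pi_pos
        positivity
      linarith
    · refine le_trans ?_ le_add_self
      rw [← ENNReal.ofReal_mul (by positivity), show (2187 : ENNReal) = ENNReal.ofReal 2187 by simp,
        ← ENNReal.ofReal_mul (by norm_num)]
      apply ENNReal.ofReal_le_ofReal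
      have hp' : (A ^ 24)⁻¹ < |ρ p - 1| := not_le.mp hp
      exact exp_far_le hA hAR hp'.le (by linarith [le_abs_self (ρ p - 1)])
        (by linarith [hρ0 p]) (hm p) (hn p)
  calc _ ≤ ∑' p : ℤ × ℤ, (Set.indicator T 1 p + 2187 * (ENNReal.ofReal (1 / (1 + (p.1 : ℝ) ^ 2)) *
        ENNReal.ofReal (1 / (1 + (p.2 : ℝ) ^ 2)))) := ENNReal.tsum_le_tsum hterm
    _ = S.card + 2187 * (Z * Z) := by
        rw [ENNReal.tsum_add, ENNReal.tsum_mul_left]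
        congr 2
        · rw [← tsum_subtype T (1 : ℤ × ℤ → ENNReal)]
          simp only [Pi.one_apply, ENNReal.tsum_one]
          rw [hS, ENat.card_coe_set_eq, hTfin.encard_eq_coe_toFinset_card]
          rfl
        · rw [ENNReal.tsum_prod']
          simp_rw [ENNReal.tsum_mul_left, ENNReal.tsum_mul_right]
          rfl
    _ ≤ _ := by
        rw [← ENNReal.ofReal_toReal hZt, ENNReal.toReal_ofReal ENNReal.toReal_nonneg, ← ENNReal.ofReal_natCast, ← ENNReal.ofReal_mul (by simp),
          show (2187 : ENNReal) = ENNReal.ofReal 2187 by simp, ← ENNReal.ofReal_mul (by norm_num),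
          ← ENNReal.ofReal_add (by positivity) (by positivity)]
        apply ENNReal.ofReal_le_ofReal
        have : 0 ≤ 2187 * Z.toReal ^ 2 := by positivity
        nlinarith

/-! ### The kernel and the estimate for the circle. -/

/-- The Gaussian weight on the lattice `A ℤ × A² ℤ`. -/
noncomputable def latticeWeight (A R : ℝ) (p : ℤ × ℤ) : ℝ :=
  Real.exp (-Real.pi * ((R / A)⁻¹) ^ 2 * (p.1 : ℝ) ^ 2) *
    Real.exp (-Real.pi * ((R / A ^ 2)⁻¹) ^ 2 * (p.2 : ℝ) ^ 2)

/-- The Gaussian kernel concentrated near the dual lattice `A⁻¹ ℤ × A⁻² ℤ`. -/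
noncomputable def dualKernel (A R : ℝ) (ξ η : Plane) : ENNReal :=
  ENNReal.ofReal (R / A) * ENNReal.ofReal (R / A ^ 2) *
    ∑' p : ℤ × ℤ, ENNReal.ofReal (Real.exp (-Real.pi * R ^ 2 *
      ((ξ 0 - p.1 / A - η 0) ^ 2 + (ξ 1 - p.2 / A ^ 2 - η 1) ^ 2)))

section
variable {A R : ℝ}

theorem summable_latticeWeight (hA : 0 < A) (hR : 0 < R) : Summable (latticeWeight A R) :=
  (summable_gaussian_int (by positivity : 0 < ((R / A)⁻¹) ^ 2)).mul_of_nonneg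
    (summable_gaussian_int (by positivity : 0 < ((R / A ^ 2)⁻¹) ^ 2))
    (fun _ => (Real.exp_pos _).le) (fun _ => (Real.exp_pos _).le)

/-- Weight and phase both factor over the two coordinates, so one-dimensional Poisson summation
applies to each, with widths R/A and R/A². -/
theorem enorm_tsum_latticeWeight_le (hA : 0 < A) (hR : 0 < R) (ξ η : Plane) :
    ‖∑' p : ℤ × ℤ, (latticeWeight A R p : ℂ) * Complex.exp (2 * Real.pi * Complex.I *
      (((p.1 * A * ξ 0 + p.2 * A ^ 2 * ξ 1) - (p.1 * A * η 0 + p.2 * A ^ 2 * η 1) : ℝ) : ℂ))‖ₑ ≤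
      dualKernel A R ξ η := by
  have hsum : ∀ (N θ : ℝ), 0 < N → Summable fun n : ℤ =>
      ‖(Real.exp (-Real.pi * (N⁻¹) ^ 2 * (n : ℝ) ^ 2) : ℂ) *
        Complex.exp (2 * Real.pi * Complex.I * ((n * θ : ℝ) : ℂ))‖ := by
    intro N θ hN
    refine (summable_gaussian_int (by positivity : 0 < (N⁻¹) ^ 2)).congr fun n => ?_
    rw [norm_mul, show 2 * Real.pi * Complex.I * ((n * θ : ℝ) : ℂ) =
      ((2 * Real.pi * (n * θ) : ℝ) : ℂ) * Complex.I by push_cast; ring,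
      Complex.norm_exp_ofReal_mul_I, mul_one, Complex.norm_real,
      Real.norm_of_nonneg (Real.exp_pos _).le]
  have hN1 : 0 < R / A := by positivity
  have hN2 : 0 < R / A ^ 2 := by positivity
  set θ₁ := A * (ξ 0 - η 0) with hθ₁
  set θ₂ := A ^ 2 * (ξ 1 - η 1) with hθ₂
  have hterm : ∀ p : ℤ × ℤ, (latticeWeight A R p : ℂ) * Complex.exp (2 * Real.pi * Complex.I *
      (((p.1 * A * ξ 0 + p.2 * A ^ 2 * ξ 1) - (p.1 * A * η 0 + p.2 * A ^ 2 * η 1) : ℝ) : ℂ)) =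
      ((Real.exp (-Real.pi * ((R / A)⁻¹) ^ 2 * (p.1 : ℝ) ^ 2) : ℂ) *
        Complex.exp (2 * Real.pi * Complex.I * ((p.1 * θ₁ : ℝ) : ℂ))) *
      ((Real.exp (-Real.pi * ((R / A ^ 2)⁻¹) ^ 2 * (p.2 : ℝ) ^ 2) : ℂ) *
        Complex.exp (2 * Real.pi * Complex.I * ((p.2 * θ₂ : ℝ) : ℂ))) := by
    intro p
    rw [mul_mul_mul_comm, ← Complex.exp_add, latticeWeight, Complex.ofReal_mul]
    congr 2
    rw [hθ₁, hθ₂]; push_cast; ring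
  simp_rw [hterm]
  rw [← tsum_mul_tsum_of_summable_norm (hsum _ θ₁ hN1) (hsum _ θ₂ hN2), enorm_mul]
  refine (mul_le_mul' (enorm_tsum_gaussian_le hN1 θ₁) (enorm_tsum_gaussian_le hN2 θ₂)).trans
    (le_of_eq ?_)
  rw [mul_mul_mul_comm, dualKernel, ENNReal.tsum_prod']
  congr 1
  rw [← ENNReal.tsum_mul_right]
  congr 1; ext m
  rw [← ENNReal.tsum_mul_left]
  congr 1; ext n
  rw [← ENNReal.ofReal_mul (Real.exp_pos _).le, ← Real.exp_add]
  congr 2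
  rw [hθ₁, hθ₂]
  field_simp
  ring

theorem dualKernel_comm (ξ η : Plane) : dualKernel A R ξ η = dualKernel A R η ξ := by
  rw [dualKernel, dualKernel]
  congr 1
  rw [← (Equiv.neg (ℤ × ℤ)).tsum_eq]
  congr 1; ext p
  congr 3
  simp only [Equiv.neg_apply, Prod.fst_neg, Prod.snd_neg]
  push_cast; ring

theorem measurable_dualKernel : Measurable (Function.uncurry (dualKernel A R)) := by
  unfold dualKernel Function.uncurry
  refine Measurable.const_mul (Measurable.tsum fun p => ?_) _
  fun_prop

end

/-- Height R²/A³, mass O(1/R) per Gaussian on the circle, and O(A^ε) effective translates multiply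
to R A^(ε - 3). -/
theorem exists_lintegral_dualKernel_le (ε : ℝ) (hε : 0 < ε) : ∃ C : ℝ, 0 < C ∧ ∀ A R : ℝ,
    1 ≤ A → A ^ 28 ≤ R → ∀ ξ : Plane, ξ 0 ^ 2 + ξ 1 ^ 2 = 1 →
    ∫⁻ η, dualKernel A R ξ η ∂circleMeasure ≤ ENNReal.ofReal (C * R * A ^ (ε - 3)) := by
  obtain ⟨C, hC0, hC⟩ := exists_tsum_exp_le ε hε
  refine ⟨4 * Real.pi * C, by positivity, fun A R hA hAR ξ hξ => ?_⟩
  have hA0 : 0 < A := by linarith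
  have hR0 : 0 < R := (by positivity : 0 < A ^ 28).trans_le hAR
  unfold dualKernel
  rw [lintegral_const_mul _ (Measurable.tsum fun p => by fun_prop),
    lintegral_tsum (fun p => by fun_prop)]
  calc _ ≤ ENNReal.ofReal (R / A) * ENNReal.ofReal (R / A ^ 2) * ∑' p : ℤ × ℤ,
        ENNReal.ofReal (4 * Real.pi / R) * ENNReal.ofReal (Real.exp (-(Real.pi / 2) * R ^ 2 *
      (Real.sqrt ((ξ 0 - p.1 / A) ^ 2 + (ξ 1 - p.2 / A ^ 2) ^ 2) - 1) ^ 2)) := by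
        gcongr with p
        rw [← ENNReal.ofReal_mul (by positivity)]
        exact lintegral_gaussian_circle_le hR0 _ _
    _ ≤ ENNReal.ofReal (R / A) * ENNReal.ofReal (R / A ^ 2) *
        (ENNReal.ofReal (4 * Real.pi / R) * ENNReal.ofReal (C * A ^ ε)) := by
        rw [ENNReal.tsum_mul_left]
        gcongr
        exact hC A R _ _ hA hAR hξ
    _ = _ := by
        rw [← ENNReal.ofReal_mul (by positivity), ← ENNReal.ofReal_mul (by positivity),
          ← ENNReal.ofReal_mul (by positivity)]
        congr 1
        rw [Real.rpow_sub hA0, show (3 : ℝ) = (3 : ℕ) by norm_num, Real.rpow_natCast]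
        field_simp

theorem inner_plane (x ξ : Plane) : (inner ℝ x ξ : ℝ) = x 0 * ξ 0 + x 1 * ξ 1 := by
  simp [PiLp.inner_apply, Fin.sum_univ_two, mul_comm]

/-- The weighted estimate over the whole lattice. -/
theorem exists_tsum_latticeWeight_le (ε : ℝ) (hε : 0 < ε) : ∃ C : ℝ, 0 < C ∧ ∀ A R : ℝ,
    1 ≤ A → A ^ 28 ≤ R → ∀ f : Plane → ℂ, MemLp f 2 circleMeasure →
    ∑' p : ℤ × ℤ, ENNReal.ofReal (latticeWeight A R p) *
      ‖fourierExt circleMeasure f !₂[p.1 * A, p.2 * A ^ 2]‖ₑ ^ 2 ≤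
      ENNReal.ofReal (C * R * A ^ (ε - 3)) * ∫⁻ ξ, ‖f ξ‖ₑ ^ 2 ∂circleMeasure := by
  obtain ⟨C, hC0, hC⟩ := exists_lintegral_dualKernel_le ε hε
  refine ⟨2 * C, by positivity, fun A R hA hAR f hf => ?_⟩
  have hA0 : 0 < A := by linarith
  have hR0 : 0 < R := (by positivity : 0 < A ^ 28).trans_le hAR
  have h1 := tsum_mul_enorm_integral_sq_le circleMeasure (latticeWeight A R)
    (fun p => by unfold latticeWeight; positivity) (summable_latticeWeight hA0 hR0)
    (fun p ξ => p.1 * A * ξ 0 + p.2 * A ^ 2 * ξ 1) (fun p => by fun_prop) f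
    (hf.integrable one_le_two)
  have hB : ∀ᵐ ξ ∂circleMeasure, ∫⁻ η, dualKernel A R ξ η ∂circleMeasure ≤
      ENNReal.ofReal (C * R * A ^ (ε - 3)) := by
    filter_upwards [ae_circleMeasure] with ξ hξ using hC A R hA hAR ξ hξ
  have h2 := lintegral_schur_le circleMeasure (dualKernel A R) measurable_dualKernel
    (ENNReal.ofReal (C * R * A ^ (ε - 3))) hB
    (by simpa only [fun ξ η : Plane => dualKernel_comm (A := A) (R := R) ξ η] using hB)
    (fun ξ => ‖f ξ‖ₑ) hf.aestronglyMeasurable.enorm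
  calc _ ≤ _ := by
        simp only [fourierExt, inner_plane]
        exact h1
    _ ≤ ∫⁻ z, ‖f z.1‖ₑ * ‖f z.2‖ₑ * dualKernel A R z.1 z.2 ∂(circleMeasure.prod circleMeasure) := by
        gcongr with z
        exact enorm_tsum_latticeWeight_le hA0 hR0 _ _
    _ ≤ _ := h2
    _ = _ := by
        rw [mul_assoc 2 C, mul_assoc 2 (C * R), ENNReal.ofReal_mul zero_le_two]
        simp

/-- The discrete restriction estimate for the circle. -/
theorem exists_l2Norm_circle_le (ε : ℝ) (hε : 0 < ε) : ∃ C : ℝ, 0 < C ∧ ∀ β R : ℝ, 0 ≤ β →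
    β ≤ 1 / 28 → 1 < R → ∀ f : Plane → ℂ, MemLp f 2 circleMeasure →
        l2Norm (latticeBox β R) (fourierExt circleMeasure f)
          ≤ ENNReal.ofReal (C * R ^ (1 / 2 - 3 / 2 * β + ε)) * eLpNorm f 2 circleMeasure := by
  -- The estimate is for the square of the norm; A^(2ε) ≤ R^(2ε) since β ≤ 1.
  obtain ⟨C, hC0, hC⟩ := exists_tsum_latticeWeight_le (2 * ε) (by positivity)
  set D := Real.exp (2 * Real.pi) * C with hD
  have hD0 : 0 < D := by positivity
  refine ⟨Real.sqrt D, by positivity, fun β R hβ0 hβ hR f hf => ?_⟩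
  have hR0 : 0 < R := by linarith
  set A := R ^ β with hAdef
  have hA : 1 ≤ A := Real.one_le_rpow hR.le hβ0
  have hA0 : 0 < A := by linarith
  have hA2 : R ^ (2 * β) = A ^ 2 := by
    rw [hAdef, ← Real.rpow_natCast, ← Real.rpow_mul hR0.le]; congr 1; push_cast; ring
  have hAR : A ^ 28 ≤ R := by
    rw [hAdef, ← Real.rpow_natCast, ← Real.rpow_mul hR0.le]
    calc R ^ (β * (28 : ℕ)) ≤ R ^ (1 : ℝ) := by
          apply Real.rpow_le_rpow_of_exponent_le hR.le; push_cast; linarith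
      _ = R := Real.rpow_one R
  have hrep : ∀ x : latticeBox β R, ∃ p : ℤ × ℤ, (x : Plane) = !₂[p.1 * A, p.2 * A ^ 2] := by
    rintro ⟨x, ⟨m, n, hm, hn⟩, -⟩
    refine ⟨(m, n), ?_⟩
    ext i
    fin_cases i
    · simpa using hm
    · simpa [← hA2] using hn
  choose π hπ using hrep
  have hinj : Function.Injective π := fun x y h => by
    apply Subtype.ext; rw [hπ x, hπ y, h]
  -- On the box each of the two Gaussian exponents is at least -π.
  have hw : ∀ x : latticeBox β R, 1 ≤ ENNReal.ofReal (Real.exp (2 * Real.pi)) *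
      ENNReal.ofReal (latticeWeight A R (π x)) := by
    intro x
    rw [← ENNReal.ofReal_mul (Real.exp_pos _).le, ← ENNReal.ofReal_one]
    apply ENNReal.ofReal_le_ofReal
    rw [latticeWeight, ← Real.exp_add, ← Real.exp_add, ← Real.exp_zero]
    apply Real.exp_le_exp.mpr
    have h0 := x.2.2.1
    have h1 := x.2.2.2
    rw [hπ x] at h0 h1
    simp only [Matrix.cons_val_zero, Matrix.cons_val_one] at h0 h1
    have sq : ∀ y : ℝ, y ∈ Set.Icc (-R) R → (R⁻¹) ^ 2 * y ^ 2 ≤ 1 := by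
      intro y hy
      have : y ^ 2 ≤ R ^ 2 := sq_le_sq' hy.1 hy.2
      rw [inv_pow, inv_mul_le_iff₀ (by positivity)]
      linarith
    have e0 := sq _ h0
    have e1 := sq _ h1
    have i0 : ((R / A)⁻¹) ^ 2 * ((π x).1 : ℝ) ^ 2 = (R⁻¹) ^ 2 * ((π x).1 * A) ^ 2 := by
      field_simp
    have i1 : ((R / A ^ 2)⁻¹) ^ 2 * ((π x).2 : ℝ) ^ 2 = (R⁻¹) ^ 2 * ((π x).2 * A ^ 2) ^ 2 := by
      field_simp
    rw [mul_assoc (-Real.pi), mul_assoc (-Real.pi), i0, i1]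
    nlinarith [Real.pi_pos]
  have hsum : ∑' x : latticeBox β R, ‖fourierExt circleMeasure f x‖ₑ ^ 2 ≤
      ENNReal.ofReal (D * R * A ^ (2 * ε - 3)) * ∫⁻ ξ, ‖f ξ‖ₑ ^ 2 ∂circleMeasure := by
    calc _ ≤ ∑' x : latticeBox β R, ENNReal.ofReal (Real.exp (2 * Real.pi)) *
          (ENNReal.ofReal (latticeWeight A R (π x)) *
            ‖fourierExt circleMeasure f !₂[(π x).1 * A, (π x).2 * A ^ 2]‖ₑ ^ 2) := by
          gcongr with x
          rw [← hπ x, ← mul_assoc]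
          exact le_mul_of_one_le_left' (hw x)
      _ ≤ ENNReal.ofReal (Real.exp (2 * Real.pi)) *
          (ENNReal.ofReal (C * R * A ^ (2 * ε - 3)) * ∫⁻ ξ, ‖f ξ‖ₑ ^ 2 ∂circleMeasure) := by
          rw [ENNReal.tsum_mul_left]
          gcongr
          exact (ENNReal.tsum_comp_le_tsum_of_injective hinj (fun p =>
            ENNReal.ofReal (latticeWeight A R p) *
              ‖fourierExt circleMeasure f !₂[p.1 * A, p.2 * A ^ 2]‖ₑ ^ 2)).trans (hC A R hA hAR f hf)
      _ = _ := by
          rw [← mul_assoc, ← ENNReal.ofReal_mul (Real.exp_pos _).le]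
          congr 2; rw [hD]; ring
  have hpow : D * R * A ^ (2 * ε - 3) ≤ (Real.sqrt D * R ^ (1 / 2 - 3 / 2 * β + ε)) ^ 2 := by
    rw [mul_pow, Real.sq_sqrt hD0.le, mul_assoc]
    gcongr
    rw [hAdef, ← Real.rpow_mul hR0.le, ← Real.rpow_natCast, ← Real.rpow_mul hR0.le]
    nth_rewrite 1 [← Real.rpow_one R]
    rw [← Real.rpow_add hR0]
    apply Real.rpow_le_rpow_of_exponent_le hR.le
    push_cast
    nlinarith
  rw [eLpNorm_eq_lintegral_rpow_enorm_toReal two_ne_zero ENNReal.ofNat_ne_top, l2Norm]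
  simp only [ENNReal.toReal_ofNat, ENNReal.rpow_ofNat]
  have hroot : ENNReal.ofReal (Real.sqrt D * R ^ (1 / 2 - 3 / 2 * β + ε)) =
      (ENNReal.ofReal (Real.sqrt D * R ^ (1 / 2 - 3 / 2 * β + ε)) ^ 2) ^ (1 / 2 : ℝ) := by
    rw [← ENNReal.rpow_natCast, ← ENNReal.rpow_mul]; norm_num
  rw [hroot, ← ENNReal.mul_rpow_of_nonneg _ _ (by norm_num)]
  gcongr
  refine hsum.trans ?_
  gcongr
  rw [← ENNReal.ofReal_pow (by positivity)]
  exact ENNReal.ofReal_le_ofReal hpow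

/-! ### Operator norms and the lower bound for the parabola. -/

theorem extOpNorm_le {s : Measure Plane} {X : Set Plane} {B : ENNReal}
    (h : ∀ f : Plane → ℂ, MemLp f 2 s → l2Norm X (fourierExt s f) ≤ B * eLpNorm f 2 s) :
    extOpNorm s X ≤ B :=
  iSup_le fun f => iSup_le fun hf => iSup_le fun h1 =>
    (h f hf).trans ((mul_le_mul_right h1 B).trans (mul_one B).le)

/-- Testing the extension operator on an indicator function on which all frequencies resonate. -/
theorem le_extOpNorm_of_resonance {s : Measure Plane} [IsFiniteMeasure s] {X T : Set Plane}
    (hT : MeasurableSet T) (hT0 : 0 < s.real T) {N : ℕ} (hN : (N : ℕ∞) ≤ X.encard)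
    (hX : ∀ x ∈ X, ∀ᵐ ξ ∂s, ξ ∈ T → 1 / 2 ≤ Real.cos (2 * Real.pi * inner ℝ x ξ)) :
    ENNReal.ofReal (Real.sqrt (N * s.real T / 4)) ≤ extOpNorm s X := by
  set W := s.real T with hW
  have hsT : s T = ENNReal.ofReal W := (ofReal_measureReal (by finiteness)).symm
  -- Normalises the indicator in L²; then Re Ef(x) ≥ (a/2)W = √W/2 at every x in X.
  set a : ℝ := (Real.sqrt W)⁻¹ with ha
  have hsW : 0 < Real.sqrt W := Real.sqrt_pos.mpr hT0
  have ha0 : 0 < a := inv_pos.mpr hsW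
  set f : Plane → ℂ := T.indicator fun _ => (a : ℂ) with hf
  have hfm : MemLp f 2 s := memLp_indicator_const 2 hT (a : ℂ) (Or.inr (by finiteness))
  have hf1 : eLpNorm f 2 s ≤ 1 := by
    rw [hf, eLpNorm_indicator_const hT two_ne_zero ENNReal.ofNat_ne_top, hsT, ← ofReal_norm,
      Complex.norm_real, Real.norm_of_nonneg ha0.le, ENNReal.ofReal_rpow_of_pos hT0,
      ← ENNReal.ofReal_mul ha0.le, ENNReal.toReal_ofNat, ← Real.sqrt_eq_rpow, ha,
      inv_mul_cancel₀ hsW.ne', ENNReal.ofReal_one]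
  have hlow : ∀ x ∈ X, Real.sqrt W / 2 ≤ ‖fourierExt s f x‖ := by
    intro x hx
    refine le_trans ?_ ((Complex.re_le_norm _))
    set e : Plane → ℂ := fun ξ => Complex.exp (2 * Real.pi * Complex.I * (inner ℝ x ξ : ℝ)) with he
    have he' : ∀ ξ, e ξ = Complex.exp ((2 * Real.pi * inner ℝ x ξ : ℝ) * Complex.I) := by
      intro ξ; rw [he]; simp only; congr 1; push_cast; ring
    have hem : Measurable e := by fun_prop
    have hen : ∀ ξ, ‖e ξ‖ ≤ 1 := fun ξ => by
      rw [he' ξ, Complex.norm_exp_ofReal_mul_I]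
    have hint : Integrable (fun ξ => f ξ * e ξ) s :=
      (hfm.integrable one_le_two).mul_bdd hem.aestronglyMeasurable
        (Filter.Eventually.of_forall hen)
    have hre : (fourierExt s f x).re = ∫ ξ, (f ξ * e ξ).re ∂s := by
      rw [fourierExt]
      exact (integral_re hint).symm
    rw [hre]
    calc Real.sqrt W / 2 = ∫ ξ, T.indicator (fun _ => a / 2) ξ ∂s := by
          rw [integral_indicator_const _ hT, smul_eq_mul, ← hW, ha]
          nth_rewrite 2 [← Real.mul_self_sqrt hT0.le]
          field_simp
      _ ≤ _ := by
          refine integral_mono_ae ((integrable_const _).indicator hT) hint.re ?_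
          filter_upwards [hX x hx] with ξ hξ
          by_cases h : ξ ∈ T
          · simp only [hf, Set.indicator_of_mem h]
            rw [he' ξ, Complex.re_ofReal_mul, Complex.exp_ofReal_mul_I_re]
            have := hξ h
            nlinarith
          · simp [hf, Set.indicator_of_notMem h]
  have key : ENNReal.ofReal (Real.sqrt (N * W / 4)) ≤ l2Norm X (fourierExt s f) := by
    rw [l2Norm, Real.sqrt_eq_rpow, ← ENNReal.ofReal_rpow_of_nonneg (by positivity) (by norm_num)]
    gcongr
    calc ENNReal.ofReal (N * W / 4) = N * ENNReal.ofReal (W / 4) := by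
          rw [mul_div_assoc, ENNReal.ofReal_mul (by positivity), ENNReal.ofReal_natCast]
      _ ≤ ∑' _ : X, ENNReal.ofReal (W / 4) := by
          rw [ENNReal.tsum_const]
          gcongr
          rw [ENat.card_coe_set_eq]
          exact_mod_cast hN
      _ ≤ _ := by
          gcongr with x
          rw [← ofReal_norm, ← ENNReal.ofReal_pow (norm_nonneg _)]
          apply ENNReal.ofReal_le_ofReal
          calc W / 4 = (Real.sqrt W / 2) ^ 2 := by rw [div_pow, Real.sq_sqrt hT0.le]; norm_num
            _ ≤ _ := by gcongr; exact hlow x x.2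
  exact key.trans (le_iSup_of_le f (le_iSup_of_le hfm (le_iSup_of_le hf1 le_rfl)))

/-- The parametrization of the parabola by the first coordinate. -/
noncomputable def parabolaPoint (t : ℝ) : Plane := !₂[t, t ^ 2]

theorem hasDerivAt_parabolaPoint (t : ℝ) : HasDerivAt parabolaPoint !₂[1, 2 * t] t := by
  have := hasDerivAt_plane (hasDerivAt_id t) (hasDerivAt_pow 2 t)
  unfold parabolaPoint
  simpa using this

theorem continuous_parabolaPoint : Continuous parabolaPoint :=
  continuous_iff_continuousAt.mpr fun t => (hasDerivAt_parabolaPoint t).continuousAt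

theorem norm_deriv_parabolaPoint (t : ℝ) : ‖deriv parabolaPoint t‖ = Real.sqrt (1 + (2 * t) ^ 2) := by
  rw [(hasDerivAt_parabolaPoint t).deriv, EuclideanSpace.norm_eq]
  simp

theorem parabolaMeasure_eq_map : parabolaMeasure =
    ((volume.restrict (Set.Icc (-1) 1)).withDensity fun t => ‖deriv parabolaPoint t‖ₑ).map
      parabolaPoint := rfl

instance : IsFiniteMeasure parabolaMeasure := by
  have : IsFiniteMeasure ((volume.restrict (Set.Icc (-1 : ℝ) 1)).withDensity
      fun t => ‖deriv parabolaPoint t‖ₑ) := by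
    refine isFiniteMeasure_withDensity ?_
    refine ((setLIntegral_mono (g := fun _ => ENNReal.ofReal 3) measurable_const fun t ht => ?_).trans_lt
      ?_).ne
    · rw [← ofReal_norm, norm_deriv_parabolaPoint]
      apply ENNReal.ofReal_le_ofReal
      apply Real.sqrt_le_iff.mpr
      have : t ^ 2 ≤ 1 := by nlinarith [ht.1, ht.2]
      constructor <;> nlinarith
    · rw [setLIntegral_const, Real.volume_Icc, ← ENNReal.ofReal_mul (by norm_num)]
      exact ENNReal.ofReal_lt_top
  rw [parabolaMeasure_eq_map]; infer_instance

theorem ae_parabolaMeasure : ∀ᵐ ξ ∂parabolaMeasure, ξ 1 = ξ 0 ^ 2 := by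
  rw [parabolaMeasure_eq_map, ae_map_iff continuous_parabolaPoint.aemeasurable
    (measurableSet_eq_fun (by fun_prop) (by fun_prop))]
  exact Filter.Eventually.of_forall fun t => by simp [parabolaPoint]

theorem volume_le_parabolaMeasure {T : Set ℝ} (hT : MeasurableSet T) (hT1 : T ⊆ Set.Icc (-1) 1) :
    volume T ≤ parabolaMeasure {ξ | ξ 0 ∈ T} := by
  have hm : MeasurableSet {ξ : Plane | ξ 0 ∈ T} := by
    have : Measurable fun ξ : Plane => ξ 0 := by fun_prop
    exact this hT
  rw [parabolaMeasure_eq_map, Measure.map_apply continuous_parabolaPoint.measurable hm]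
  have : parabolaPoint ⁻¹' {ξ : Plane | ξ 0 ∈ T} = T := by
    ext t; simp [parabolaPoint]
  rw [this, withDensity_apply _ hT, Measure.restrict_restrict hT, Set.inter_eq_left.mpr hT1]
  calc volume T = ∫⁻ _ in T, 1 := by simp
    _ ≤ _ := by
      refine lintegral_mono fun t => ?_
      rw [← ofReal_norm, norm_deriv_parabolaPoint, ← ENNReal.ofReal_one]
      apply ENNReal.ofReal_le_ofReal
      apply Real.le_sqrt_of_sq_le
      nlinarith [sq_nonneg t]

/-- A union of `J` short intervals starting at the points `j / A`. -/
def capUnion (A δ : ℝ) (J : ℕ) : Set ℝ :=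
  ⋃ j ∈ Finset.range J, Set.Icc ((j : ℝ) / A) (j / A + δ)

theorem measurableSet_capUnion (A δ : ℝ) (J : ℕ) : MeasurableSet (capUnion A δ J) :=
  Finset.measurableSet_biUnion _ fun _ _ => measurableSet_Icc

theorem volume_capUnion {A δ : ℝ} (hA : 0 < A) (hδ : δ < 1 / A) (J : ℕ) :
    volume (capUnion A δ J) = ENNReal.ofReal (J * δ) := by
  rw [capUnion, measure_biUnion_finset _ fun _ _ => measurableSet_Icc]
  · simp only [Real.volume_Icc, add_sub_cancel_left, Finset.sum_const, Finset.card_range,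
      nsmul_eq_mul]
    rw [ENNReal.ofReal_mul (by positivity), ENNReal.ofReal_natCast]
  · intro i _ j _ hij
    wlog h : i < j generalizing i j
    · exact (this (by assumption) (by assumption) hij.symm
        (lt_of_le_of_ne (not_lt.mp h) hij.symm)).symm
    refine Set.disjoint_left.mpr fun t hi hj => ?_
    have h1 : (i : ℝ) + 1 ≤ j := by exact_mod_cast h
    have h2 : ((i : ℝ) + 1) / A ≤ j / A := by gcongr
    rw [add_div] at h2
    linarith [hi.2, hj.1]

theorem capUnion_subset {A δ : ℝ} (hA : 0 < A) (hδ : δ < 1 / A) {J : ℕ} (hJ : (J : ℝ) ≤ A) :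
    capUnion A δ J ⊆ Set.Icc (-1) 1 := by
  intro t ht
  simp only [capUnion, Set.mem_iUnion, Finset.mem_range, exists_prop] at ht
  obtain ⟨j, hj, h1, h2⟩ := ht
  have h3 : (j : ℝ) + 1 ≤ A := le_trans (by exact_mod_cast hj) hJ
  have h4 : ((j : ℝ) + 1) / A ≤ 1 := (div_le_one hA).mpr h3
  rw [add_div] at h4
  have : 0 ≤ (j : ℝ) / A := by positivity
  exact ⟨by linarith, by linarith⟩

/-- On the caps, all lattice frequencies resonate. -/
theorem half_le_cos_of_mem_capUnion {A R t : ℝ} (hA : 0 < A) (hR : 1 ≤ R) {J : ℕ}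
    (hJ : (J : ℝ) ≤ A) (ht : t ∈ capUnion A (1 / (20 * R)) J) {m n : ℤ} (hm : |m * A| ≤ R)
    (hn : |n * A ^ 2| ≤ R) :
    1 / 2 ≤ Real.cos (2 * Real.pi * (m * A * t + n * A ^ 2 * t ^ 2)) := by
  simp only [capUnion, Set.mem_iUnion, Finset.mem_range, exists_prop] at ht
  obtain ⟨j, hj, h1, h2⟩ := ht
  set u := t - j / A with hu
  have hu0 : 0 ≤ u := by linarith
  have hu1 : u ≤ 1 / (20 * R) := by linarith
  have htu : t = j / A + u := by rw [hu]; ring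
  have hjA : (j : ℝ) / A ≤ 1 := (div_le_one hA).mpr (le_trans (by exact_mod_cast hj.le) hJ)
  set ψ := m * A * u + 2 * (n * A ^ 2 * (j / A) * u) + n * A ^ 2 * u ^ 2 with hψ
  -- At t = j/A the phase is the integer mj + nj². The cap length 1/(20R) keeps the remainder ψ
  -- below 3/20 + 1/400 ≤ 1/6, an angle of at most π/3.
  have hid : 2 * Real.pi * (m * A * t + n * A ^ 2 * t ^ 2) =
      2 * Real.pi * ψ + ((m * j + n * j ^ 2 : ℤ) : ℝ) * (2 * Real.pi) := by
    rw [hψ, htu]; push_cast; field_simp; ring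
  rw [hid, Real.cos_add_int_mul_two_pi, ← Real.cos_abs, ← Real.cos_pi_div_three]
  have hRu : R * u ≤ 1 / 20 := by
    calc R * u ≤ R * (1 / (20 * R)) := by gcongr
      _ = 1 / 20 := by field_simp
  have hu2 : u ≤ 1 / 20 := by nlinarith
  have hψb : |ψ| ≤ 1 / 6 := by
    calc |ψ| ≤ |m * A * u| + |2 * (n * A ^ 2 * (j / A) * u)| + |n * A ^ 2 * u ^ 2| :=
          abs_add_three _ _ _
      _ = |m * A| * u + 2 * (|n * A ^ 2| * (j / A) * u) + |n * A ^ 2| * u ^ 2 := by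
          rw [abs_mul (m * A), abs_mul 2, abs_mul _ u, abs_mul _ ((j : ℝ) / A), abs_mul _ (u ^ 2),
            abs_of_nonneg hu0, abs_of_nonneg (by positivity : 0 ≤ (j : ℝ) / A),
            abs_of_nonneg (by positivity : 0 ≤ u ^ 2), abs_of_pos (two_pos : (0 : ℝ) < 2)]
      _ ≤ R * u + 2 * (R * 1 * u) + R * u ^ 2 := by gcongr
      _ = 3 * (R * u) + (R * u) * u := by ring
      _ ≤ 3 * (1 / 20) + (1 / 20) * (1 / 20) := by gcongr
      _ ≤ 1 / 6 := by norm_num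
  have hp := Real.pi_pos
  apply Real.cos_le_cos_of_nonneg_of_le_pi (abs_nonneg _) (by linarith)
  rw [abs_mul, abs_of_pos (by positivity : 0 < 2 * Real.pi)]
  nlinarith

theorem le_encard_latticeBox {β R : ℝ} (hR : 0 < R) :
    (((2 * ⌊R / R ^ β⌋₊ + 1) * (2 * ⌊R / R ^ (2 * β)⌋₊ + 1) : ℕ) : ℕ∞) ≤
      (latticeBox β R).encard := by
  set k := ⌊R / R ^ β⌋₊
  set l := ⌊R / R ^ (2 * β)⌋₊
  have hA : 0 < R ^ β := by positivity
  have hB : 0 < R ^ (2 * β) := by positivity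
  set F : ℤ × ℤ → Plane := fun p => !₂[p.1 * R ^ β, p.2 * R ^ (2 * β)] with hF
  have hinj : Function.Injective F := by
    intro p q h
    have h0 := congrArg (fun x : Plane => x 0) h
    have h1 := congrArg (fun x : Plane => x 1) h
    simp only [hF, Matrix.cons_val_zero, Matrix.cons_val_one] at h0 h1
    exact Prod.ext (by exact_mod_cast mul_right_cancel₀ hA.ne' h0)
      (by exact_mod_cast mul_right_cancel₀ hB.ne' h1)
  set S : Finset (ℤ × ℤ) := Finset.Icc (-k : ℤ) k ×ˢ Finset.Icc (-l : ℤ) l with hS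
  have hcard : S.card = (2 * k + 1) * (2 * l + 1) := by
    rw [hS, Finset.card_product, Int.card_Icc, Int.card_Icc]
    congr 1 <;> omega
  have aux : ∀ (B : ℝ) (r : ℤ), 0 < B → -(⌊R / B⌋₊ : ℤ) ≤ r → r ≤ ⌊R / B⌋₊ →
      r * B ∈ Set.Icc (-R) R := by
    intro B r hB h1 h2
    have hf : (⌊R / B⌋₊ : ℝ) * B ≤ R := by
      rw [← le_div_iff₀ hB]; exact Nat.floor_le (by positivity)
    have h1' : -(⌊R / B⌋₊ : ℝ) ≤ r := by exact_mod_cast h1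
    have h2' : (r : ℝ) ≤ ⌊R / B⌋₊ := by exact_mod_cast h2
    constructor <;> nlinarith
  rw [← hcard, ← Set.encard_coe_eq_coe_finsetCard, ← hinj.encard_image]
  apply Set.encard_le_encard
  rintro _ ⟨p, hp, rfl⟩
  simp only [hS, Finset.coe_product, Finset.coe_Icc, Set.mem_prod, Set.mem_Icc] at hp
  refine ⟨⟨p.1, p.2, by simp [hF], by simp [hF]⟩, ?_, ?_⟩
  · simpa [hF] using aux _ p.1 hA hp.1.1 hp.1.2
  · simpa [hF] using aux _ p.2 hB hp.2.1 hp.2.2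

/-- The lower bound for the parabola. -/
theorem le_extOpNorm_parabola {β R : ℝ} (hβ0 : 0 ≤ β) (hβ : β ≤ 1 / 2) (hR : 1 < R) :
    ENNReal.ofReal (1 / 16 * R ^ (1 / 2 - β)) ≤ extOpNorm parabolaMeasure (latticeBox β R) := by
  have hR0 : 0 < R := by linarith
  set A := R ^ β with hAdef
  have hA1 : 1 ≤ A := Real.one_le_rpow hR.le hβ0
  have hA0 : 0 < A := by linarith
  have hAR : A ≤ R := by
    calc A ≤ R ^ (1 : ℝ) := Real.rpow_le_rpow_of_exponent_le hR.le (by linarith)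
      _ = R := Real.rpow_one R
  have hA2 : R ^ (2 * β) = A ^ 2 := by
    rw [hAdef, ← Real.rpow_natCast, ← Real.rpow_mul hR0.le]; congr 1; push_cast; ring
  set J := ⌊A⌋₊ with hJdef
  have hJ : (J : ℝ) ≤ A := Nat.floor_le hA0.le
  have hJ2 : A / 2 ≤ J := by
    have h1 : (1 : ℝ) ≤ J := by exact_mod_cast (Nat.one_le_floor_iff A).mpr hA1
    have h2 := Nat.lt_floor_add_one A
    linarith
  set T := capUnion A (1 / (20 * R)) J with hT
  have hδ : 1 / (20 * R) < 1 / A := one_div_lt_one_div_of_lt hA0 (by linarith)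
  have hTm : MeasurableSet {ξ : Plane | ξ 0 ∈ T} := by
    have : Measurable fun ξ : Plane => ξ 0 := by fun_prop
    exact this (measurableSet_capUnion _ _ _)
  have hW : A / (40 * R) ≤ parabolaMeasure.real {ξ | ξ 0 ∈ T} := by
    have h1 := volume_le_parabolaMeasure (measurableSet_capUnion _ _ _) (capUnion_subset hA0 hδ hJ)
    rw [volume_capUnion hA0 hδ, ← ofReal_measureReal (by finiteness),
      ENNReal.ofReal_le_ofReal_iff measureReal_nonneg] at h1
    refine le_trans ?_ h1
    calc A / (40 * R) = A / 2 * (1 / (20 * R)) := by field_simp; norm_num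
      _ ≤ _ := by gcongr
  have hres : ∀ x ∈ latticeBox β R, ∀ᵐ ξ ∂parabolaMeasure, ξ ∈ {ξ : Plane | ξ 0 ∈ T} →
      1 / 2 ≤ Real.cos (2 * Real.pi * inner ℝ x ξ) := by
    rintro x ⟨⟨m, n, hm, hn⟩, hx0, hx1⟩
    filter_upwards [ae_parabolaMeasure] with ξ hξ hξT
    rw [inner_plane, hξ, hm, hn, hA2]
    rw [hm] at hx0
    rw [hn, hA2] at hx1
    exact half_le_cos_of_mem_capUnion hA0 hR.le hJ hξT (abs_le.mpr hx0) (abs_le.mpr hx1)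
  refine le_trans ?_ (le_extOpNorm_of_resonance hTm
    ((by positivity : 0 < A / (40 * R)).trans_le hW) (le_encard_latticeBox hR0) hres)
  apply ENNReal.ofReal_le_ofReal
  apply Real.le_sqrt_of_sq_le
  -- Counting multiples on both sides of 0 as well as 0 itself gives at least (R/A)(R/A²) lattice
  -- points without any loss from the floors.
  have hfl : ∀ y : ℝ, 0 ≤ y → y ≤ 2 * (⌊y⌋₊ : ℝ) + 1 := fun y _ => by
    have := Nat.lt_floor_add_one y
    have h0 : (0 : ℝ) ≤ (⌊y⌋₊ : ℝ) := by positivity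
    linarith
  -- Points times cap measure over 4 is at least R/(160A²), and 1/16² ≤ 1/160.
  calc (1 / 16 * R ^ (1 / 2 - β)) ^ 2 = 1 / 256 * (R / A ^ 2) := by
        rw [mul_pow, ← Real.rpow_natCast (R ^ (1 / 2 - β)) 2, ← Real.rpow_mul hR0.le, ← hA2,
          show (1 / 2 - β) * ((2 : ℕ) : ℝ) = 1 - 2 * β by push_cast; ring, Real.rpow_sub hR0,
          Real.rpow_one]
        norm_num
    _ ≤ 1 / 160 * (R / A ^ 2) := by gcongr; norm_num
    _ = (R / A) * (R / A ^ 2) * (A / (40 * R)) / 4 := by field_simp; norm_num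
    _ ≤ _ := by
        push_cast
        rw [hA2]
        gcongr
        · exact hfl _ (by positivity)
        · exact hfl _ (by positivity)

theorem theorem2 :
    -- The circle: the operator norm bound, and the same bound as an inequality for every `f`.
    (∀ ε : ℝ, 0 < ε → ∃ C : ℝ, 0 < C ∧ ∀ β R : ℝ, 0 ≤ β → β ≤ 1 / 28 → 1 < R →
      extOpNorm circleMeasure (latticeBox β R)
          ≤ ENNReal.ofReal (C * R ^ (1 / 2 - 3 / 2 * β + ε)) ∧
      ∀ f : Plane → ℂ, MemLp f 2 circleMeasure →
        l2Norm (latticeBox β R) (fourierExt circleMeasure f)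
          ≤ ENNReal.ofReal (C * R ^ (1 / 2 - 3 / 2 * β + ε)) * eLpNorm f 2 circleMeasure) ∧
    -- The parabola: the lower bound on the same sets.
    (∃ c : ℝ, 0 < c ∧ ∀ β R : ℝ, 0 ≤ β → β ≤ 1 / 2 → 1 < R →
      ENNReal.ofReal (c * R ^ (1 / 2 - β))
        ≤ extOpNorm parabolaMeasure (latticeBox β R)) := by
  refine ⟨fun ε hε => ?_, 1 / 16, by norm_num, fun β R hβ0 hβ hR => le_extOpNorm_parabola hβ0 hβ hR⟩
  obtain ⟨C, hC0, hC⟩ := exists_l2Norm_circle_le ε hε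
  exact ⟨C, hC0, fun β R hβ0 hβ hR =>
    ⟨extOpNorm_le fun f hf => hC β R hβ0 hβ hR f hf, fun f hf => hC β R hβ0 hβ hR f hf⟩⟩
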